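/- **Conventions.** All algebras are complex. A Banach $^*$-algebra is a (not necessarily unital) Banach algebra with an isometric involution. For a Banach $^*$-algebra $\mathfrak B$, a multiplier is a pair of bounded linear maps $b\mapsto ub$, $b\mapsto bu$ on $\mathfrak B$ with $(au)b=a(ub)$, $u(ab)=(ua)b$, $(ab)u=a(bu)$; $\mathcal{UM}(\mathfrak B)$ is the group of multipliers $u$ with $u^*u=uu^*=1$ and $\|ub\|\le\|b\|$, $\|bu\|\le\|b\|$ for all $b$; ${\rm Aut}_1(\mathfrak B)$ is the group of isometric $^*$-automorphisms of $\mathfrak B$, which act on multipliers by $\alpha(u)b=\alpha(u\,\alpha^{-1}(b))$, $b\,\alpha(u)=\alpha(\alpha^{-1}(b)\,u)$. A map from a topological space to a Banach space is strongly Borel if it is Borel and maps every compact set onto a separable set. A (measurable) twisted action $({\sf G},\alpha,\omega,\mathfrak B)$ consists of a Hausdorff locally compact group ${\sf G}$, a Banach $^*$-algebra $\mathfrak B$ and maps $\alpha:{\sf G}\to{\rm Aut}_1(\mathfrak B)$, $\omega:{\sf G}\times{\sf G}\to\mathcal{UM}(\mathfrak B)$ such that for every $b\in\mathfrak B$ the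 maps $x\mapsto\alpha_x(b)$, $(x,y)\mapsto\omega(x,y)b$ and $(x,y)\mapsto b\,\omega(x,y)$ are strongly Borel, and for all $x,y,z\in{\sf G}$, $b\in\mathfrak B$, $$\alpha_x(\omega(y,z))\,\omega(x,yz)=\omega(x,y)\,\omega(xy,z),\qquad \alpha_x(\alpha_y(b))\,\omega(x,y)=\omega(x,y)\,\alpha_{xy}(b),$$ $$\omega(x,{\sf e})=\omega({\sf e},y)=1,\qquad \alpha_{\sf e}={\rm id}.$$ Fix a left Haar measure ${\rm d}x$ on ${\sf G}$ and let $\Delta$ be the modular function, so that a Borel set $E$ satisfies $|Ex|=\Delta(x)|E|$ if it has finite measure. $L^1_{\alpha,\omega}({\sf G},\mathfrak B)$ is the space of classes of Bochner integrable functions $\Phi:{\sf G}\to\mathfrak B$ with norm $\int_{\sf G}\|\Phi(x)\|_{\mathfrak B}\,{\rm d}x$ and the operations $$\Phi*\Psi(x)=\int_{\sf G}\Phi(y)\,\alpha_y[\Psi(y^{-1}x)]\,\omega(y,y^{-1}x)\,{\rm d}y,\qquad \Phi^*(x)=\Delta(x^{-1})\,\omega(x,x^{-1})^*\,\alpha_x[\Phi(x^{-1})^*].$$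 Let $\mathfrak A\subset\mathfrak B$ be Banach $^*$-algebras, each with its own complete norm, $\mathfrak A$ being a $^*$-subalgebra of $\mathfrak B$ with continuous inclusion. $\mathfrak A$ is a differential subalgebra of $\mathfrak B$ if an identity of $\mathfrak A$, when there is one, is an identity of $\mathfrak B$, and there is a constant $C>0$ with $$\|ab\|_{\mathfrak A}\le C\big(\|a\|_{\mathfrak A}\|b\|_{\mathfrak B}+\|a\|_{\mathfrak B}\|b\|_{\mathfrak A}\big)\quad\text{for all }a,b\in\mathfrak A.$$ It is inverse-closed in $\mathfrak B$ if ${\rm Spec}_{\mathfrak A}(a)={\rm Spec}_{\mathfrak B}(a)$ for all $a\in\mathfrak A$, where the spectrum in an algebra without identity is the spectrum in its unitization. $\mathfrak A$ is stable under $({\sf G},\alpha,\omega,\mathfrak B)$ if the twisted action restricts to $\mathfrak A$: the automorphisms $\alpha_x$ and the left and right multiplications by $\omega(x,y)$ map $\mathfrak A$ into $\mathfrak A$, and their restrictions form a measurable twisted action $({\sf G},\alpha,\omega,\mathfrak A)$ on the Banach $^*$-algebra $\mathfrak A$. **Lemma 2.6.** Let $({\sf G},\alpha,\omega,\mathfrak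 B)$ be a measurable twisted action, and let $\mathfrak A$ be a dense differential subalgebra of $\mathfrak B$ that is stable under it. Then the operations above are well defined on $L^1_{\alpha,\omega}({\sf G},\mathfrak A)$ and $L^1_{\alpha,\omega}({\sf G},\mathfrak B)$ (the convolution integrals converge for almost every $x$, and the results are integrable), both are Banach $^*$-algebras, and $L^1_{\alpha,\omega}({\sf G},\mathfrak A)$, with its natural inclusion, is a dense differential subalgebra of $L^1_{\alpha,\omega}({\sf G},\mathfrak B)$. In particular, $L^1_{\alpha,\omega}({\sf G},\mathfrak A)$ is inverse-closed in $L^1_{\alpha,\omega}({\sf G},\mathfrak B)$. -/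

import Mathlib

open MeasureTheory
open scoped MultiplierAlgebra

/-- The axioms of a Banach `*`-algebra over `ℂ` with isometric involution, for a complex normed
space that carries a multiplication and a star operation. No unit is required. -/
structure IsBanachStarAlgebra (A : Type*) [NormedAddCommGroup A] [NormedSpace ℂ A]
    [Mul A] [Star A] : Prop where
  complete : CompleteSpace A
  mul_assoc : ∀ a b c : A, a * b * c = a * (b * c)
  add_mul : ∀ a b c : A, (a + b) * c = a * c + b * c
  mul_add : ∀ a b c : A, a * (b + c) = a * b + a * c
  smul_mul : ∀ (z : ℂ) (a b : A), (z • a) * b = z • (a * b)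
  mul_smul : ∀ (z : ℂ) (a b : A), a * (z • b) = z • (a * b)
  norm_mul_le : ∀ a b : A, ‖a * b‖ ≤ ‖a‖ * ‖b‖
  star_star : ∀ a : A, star (star a) = a
  star_mul : ∀ a b : A, star (a * b) = star b * star a
  star_add : ∀ a b : A, star (a + b) = star a + star b
  star_smul : ∀ (z : ℂ) (a : A), star (z • a) = (starRingEnd ℂ z) • star a
  norm_star : ∀ a : A, ‖star a‖ = ‖a‖

/-- `e` is a two-sided identity for the multiplication of `A`. -/
def IsIdentity {A : Type*} [Mul A] (e : A) : Prop :=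
  ∀ a : A, e * a = a ∧ a * e = a

/-- `A`, with its own norm, is a differential subalgebra of `B`. The inclusion of the Banach
`*`-subalgebra `A` into `B` is the map `ι`, an injective continuous `*`-homomorphism. -/
structure IsDifferentialSubalgebra {A B : Type*}
    [NormedAddCommGroup A] [NormedSpace ℂ A] [Mul A] [Star A]
    [NormedAddCommGroup B] [NormedSpace ℂ B] [Mul B] [Star B] (ι : A →L[ℂ] B) : Prop where
  banach_left : IsBanachStarAlgebra A
  banach_right : IsBanachStarAlgebra B
  injective : Function.Injective ι
  map_mul : ∀ a b : A, ι (a * b) = ι a * ι b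
  map_star : ∀ a : A, ι (star a) = star (ι a)
  map_identity : ∀ e : A, IsIdentity e → IsIdentity (ι e)
  norm_mul_le : ∃ C : ℝ, 0 < C ∧
    ∀ a b : A, ‖a * b‖ ≤ C * (‖a‖ * ‖ι b‖ + ‖ι a‖ * ‖b‖)

/-- The spectrum of an element of a complex algebra: taken in `A` itself if `A` has an identity,
and in the unitization `ℂ ⊕ A` if `A` has none. -/
def algSpectrum {A : Type*} [NormedAddCommGroup A] [NormedSpace ℂ A] [Mul A] (a : A) : Set ℂ :=
  {z | (∀ e : A, IsIdentity e →
          ¬ ∃ b : A, (z • e - a) * b = e ∧ b * (z • e - a) = e) ∧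
       ((¬ ∃ e : A, IsIdentity e) →
          ¬ ∃ u : Unitization ℂ A,
            ((Unitization.inl z : Unitization ℂ A) - (a : Unitization ℂ A)) * u = 1 ∧
            u * ((Unitization.inl z : Unitization ℂ A) - (a : Unitization ℂ A)) = 1)}

/-- `A` is inverse-closed (spectrally invariant) in `B`, the inclusion being `ι`. -/
def IsInverseClosed {A B : Type*}
    [NormedAddCommGroup A] [NormedSpace ℂ A] [Mul A]
    [NormedAddCommGroup B] [NormedSpace ℂ B] [Mul B] (ι : A →L[ℂ] B) : Prop :=
  ∀ a : A, algSpectrum a = algSpectrum (ι a)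

/-- A Borel map whose values on each compact set form a separable set, that is, a Borel map which
is on every compact set a pointwise limit of simple Borel functions. -/
def IsStronglyBorel {X E : Type*} [TopologicalSpace X] [TopologicalSpace E] (f : X → E) : Prop :=
  @Measurable X E (borel X) (borel E) f ∧
    ∀ K : Set X, IsCompact K → TopologicalSpace.IsSeparable (f '' K)

section TwistedAction

variable {B : Type*} [NonUnitalNormedRing B] [StarRing B] [NormedStarGroup B] [NormedSpace ℂ B]
  [IsScalarTower ℂ B B] [SMulCommClass ℂ B B] [StarModule ℂ B]

/-- The elements of the unitary group of the multiplier algebra. A multiplier `u` is a pair of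
maps `u.fst : b ↦ u b` and `u.snd : b ↦ b u` with `(a u) b = a (u b)`. The rules
`u (a b) = (u a) b` and `(a b) u = a (b u)` follow from this when `B` has no annihilators, and
are part of the definition of a multiplier in general. As the automorphisms of `B`, the
unitary multipliers are taken to be of norm one (automatic in a `C*`-algebra). -/
structure IsUnitaryMultiplier (u : 𝓜(ℂ, B)) : Prop where
  fst_mul : ∀ a b : B, u.fst (a * b) = u.fst a * b
  snd_mul : ∀ a b : B, u.snd (a * b) = a * u.snd b
  star_mul_self : star u * u = 1
  mul_star_self : u * star u = 1
  norm_le_one : ‖u‖ ≤ 1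

/-- An isometric `*`-automorphism as a continuous linear map. -/
noncomputable def isometricAutCLM (L : B ≃⋆ₐ[ℂ] B) (hL : ∀ b, ‖L b‖ = ‖b‖) : B →L[ℂ] B :=
  LinearMap.mkContinuous
    { toFun := L, map_add' := map_add L, map_smul' := fun z b => map_smul L z b } 1
    (fun b => by simp [hL])

/-- The extension of an isometric `*`-automorphism `L` of `B` to the multiplier algebra:
`L(m) b = L (m (L⁻¹ b))` and `b L(m) = L ((L⁻¹ b) m)`. -/
noncomputable def multiplierMap (L : B ≃⋆ₐ[ℂ] B) (hL : ∀ b, ‖L b‖ = ‖b‖) (m : 𝓜(ℂ, B)) :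
    𝓜(ℂ, B) where
  fst := (isometricAutCLM L hL).comp
    (m.fst.comp (isometricAutCLM L.symm (fun b => by simpa using (hL (L.symm b)).symm)))
  snd := (isometricAutCLM L hL).comp
    (m.snd.comp (isometricAutCLM L.symm (fun b => by simpa using (hL (L.symm b)).symm)))
  central := fun x y => by
    have h := congrArg L (m.central (L.symm x) (L.symm y))
    simpa [isometricAutCLM] using h

end TwistedAction

/-- A measurable twisted action `(G, α, ω, B)` of a topological group on a Banach `*`-algebra:
isometric `*`-automorphisms `α_x` and unitary multipliers `ω(x, y)`, strongly Borel, such that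
`α_x(ω(y, z)) ω(x, y z) = ω(x, y) ω(x y, z)`, `α_x(α_y(b)) ω(x, y) = ω(x, y) α_{xy}(b)`,
`ω(x, 1) = ω(1, y) = 1` and `α_1 = id`. -/
structure TwistedAction (G B : Type*) [Group G] [TopologicalSpace G]
    [NonUnitalNormedRing B] [StarRing B] [NormedStarGroup B] [NormedSpace ℂ B]
    [IsScalarTower ℂ B B] [SMulCommClass ℂ B B] [StarModule ℂ B] where
  α : G → (B ≃⋆ₐ[ℂ] B)
  ω : G → G → 𝓜(ℂ, B)
  norm_α : ∀ x b, ‖α x b‖ = ‖b‖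
  unitary_ω : ∀ x y, IsUnitaryMultiplier (ω x y)
  borel_α : ∀ b, IsStronglyBorel (fun x => α x b)
  borel_ω_fst : ∀ b, IsStronglyBorel (fun p : G × G => (ω p.1 p.2).fst b)
  borel_ω_snd : ∀ b, IsStronglyBorel (fun p : G × G => (ω p.1 p.2).snd b)
  cocycle : ∀ x y z,
    multiplierMap (α x) (norm_α x) (ω y z) * ω x (y * z) = ω x y * ω (x * y) z
  twist : ∀ x y b, (ω x y).snd (α x (α y b)) = (ω x y).fst (α (x * y) b)
  ω_one_right : ∀ x, ω x 1 = 1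
  ω_one_left : ∀ y, ω 1 y = 1
  α_one : ∀ b, α 1 b = b

namespace TwistedAction

section Stable

variable {G A B : Type*} [Group G] [TopologicalSpace G]
  [NonUnitalNormedRing A] [StarRing A] [NormedStarGroup A] [NormedSpace ℂ A]
  [IsScalarTower ℂ A A] [SMulCommClass ℂ A A] [StarModule ℂ A]
  [NonUnitalNormedRing B] [StarRing B] [NormedStarGroup B] [NormedSpace ℂ B]
  [IsScalarTower ℂ B B] [SMulCommClass ℂ B B] [StarModule ℂ B]

/-- The subalgebra `A` of `B` (with inclusion `ι`) is stable under the twisted action `T` on `B`,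
and `S` is the twisted action on `A` to which `T` restricts. -/
structure RestrictsTo (T : TwistedAction G B) (ι : A →L[ℂ] B) (S : TwistedAction G A) :
    Prop where
  map_α : ∀ x a, ι (S.α x a) = T.α x (ι a)
  map_ω_fst : ∀ x y a, ι ((S.ω x y).fst a) = (T.ω x y).fst (ι a)
  map_ω_snd : ∀ x y a, ι ((S.ω x y).snd a) = (T.ω x y).snd (ι a)

end Stable

section L1

variable {G B : Type*} [Group G] [TopologicalSpace G] [IsTopologicalGroup G]
  [LocallyCompactSpace G] [MeasurableSpace G] [BorelSpace G]
  [NonUnitalNormedRing B] [StarRing B] [NormedStarGroup B] [NormedSpace ℂ B]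
  [IsScalarTower ℂ B B] [SMulCommClass ℂ B B] [StarModule ℂ B]

/-- The integrand `Φ(y) α_y[Ψ(y⁻¹x)] ω(y, y⁻¹x)` of the twisted convolution at `x`. -/
noncomputable def convIntegrand (T : TwistedAction G B) (Φ Ψ : G → B) (x y : G) : B :=
  (T.ω y (y⁻¹ * x)).snd (Φ y * T.α y (Ψ (y⁻¹ * x)))

/-- The twisted convolution `Φ * Ψ` of two functions. -/
noncomputable def conv (T : TwistedAction G B) (μ : Measure G) (Φ Ψ : G → B) (x : G) : B :=
  ∫ y, T.convIntegrand Φ Ψ x y ∂μ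

/-- The modular function `Δ` of `G`, normalized by `μ (E x) = Δ(x) μ(E)` for a left Haar measure
`μ`. Mathlib's `modularCharacterFun` is normalized by `μ (E x⁻¹) = modularCharacterFun x • μ E`. -/
noncomputable def modularFunction (G : Type*) [Group G] [TopologicalSpace G]
    [IsTopologicalGroup G] [LocallyCompactSpace G] (x : G) : ℝ :=
  (Measure.modularCharacterFun x⁻¹ : ℝ)

/-- The twisted involution `Φ^*(x) = Δ(x⁻¹) ω(x, x⁻¹)^* α_x[Φ(x⁻¹)^*]` of a function. -/
noncomputable def invol (T : TwistedAction G B) (Φ : G → B) (x : G) : B :=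
  (modularFunction G x⁻¹ : ℂ) • (star (T.ω x x⁻¹)).fst (T.α x (star (Φ x⁻¹)))

/-- The space `L¹_{α,ω}(G, B)` of (classes of) Bochner integrable functions. -/
def L1 (_T : TwistedAction G B) (μ : Measure G) : Type _ := Lp B 1 μ

noncomputable instance (T : TwistedAction G B) (μ : Measure G) : NormedAddCommGroup (T.L1 μ) :=
  inferInstanceAs (NormedAddCommGroup (Lp B 1 μ))

noncomputable instance (T : TwistedAction G B) (μ : Measure G) : NormedSpace ℂ (T.L1 μ) :=
  inferInstanceAs (NormedSpace ℂ (Lp B 1 μ))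

/-- A representative of an element of `L¹_{α,ω}(G, B)`. -/
noncomputable def L1.fn {T : TwistedAction G B} {μ : Measure G} (Φ : T.L1 μ) : G → B :=
  ((show Lp B 1 μ from Φ) : G → B)

open Classical in
/-- The class in `L¹_{α,ω}(G, B)` of a function, with the value `0` if it is not integrable. -/
noncomputable def L1.mk (T : TwistedAction G B) (μ : Measure G) (F : G → B) : T.L1 μ :=
  if h : Integrable F μ then (show T.L1 μ from h.toL1 F) else 0

noncomputable instance (T : TwistedAction G B) (μ : Measure G) : Mul (T.L1 μ) :=
  ⟨fun Φ Ψ => L1.mk T μ (T.conv μ Φ.fn Ψ.fn)⟩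

noncomputable instance (T : TwistedAction G B) (μ : Measure G) : Star (T.L1 μ) :=
  ⟨fun Φ => L1.mk T μ (T.invol Φ.fn)⟩

/-- The convolution integrals of integrable functions converge almost everywhere, and convolution
and involution of integrable functions are integrable, so that the default values of `∫` and of
`L1.mk` do not enter in the operations of `L¹_{α,ω}(G, B)`. -/
structure L1OperationsDefined (T : TwistedAction G B) (μ : Measure G) : Prop where
  integrable_integrand : ∀ Φ Ψ : T.L1 μ, ∀ᵐ x ∂μ, Integrable (T.convIntegrand Φ.fn Ψ.fn x) μ
  integrable_conv : ∀ Φ Ψ : T.L1 μ, Integrable (T.conv μ Φ.fn Ψ.fn) μ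
  integrable_invol : ∀ Φ : T.L1 μ, Integrable (T.invol Φ.fn) μ

end L1

section Inclusion

variable {G A B : Type*} [Group G] [TopologicalSpace G] [IsTopologicalGroup G]
  [LocallyCompactSpace G] [MeasurableSpace G] [BorelSpace G]
  [NonUnitalNormedRing A] [StarRing A] [NormedStarGroup A] [NormedSpace ℂ A]
  [IsScalarTower ℂ A A] [SMulCommClass ℂ A A] [StarModule ℂ A]
  [NonUnitalNormedRing B] [StarRing B] [NormedStarGroup B] [NormedSpace ℂ B]
  [IsScalarTower ℂ B B] [SMulCommClass ℂ B B] [StarModule ℂ B]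

/-- The natural map `L¹_{α,ω}(G, A) → L¹_{α,ω}(G, B)`, `Φ ↦ ι ∘ Φ`. -/
noncomputable def L1incl (S : TwistedAction G A) (T : TwistedAction G B) (μ : Measure G)
    (ι : A →L[ℂ] B) : S.L1 μ →L[ℂ] T.L1 μ :=
  show Lp A 1 μ →L[ℂ] Lp B 1 μ from ι.compLpL 1 μ

end Inclusion

end TwistedAction

/-! The differential inequality passes to `L¹` fibrewise. Each `α_y` is isometric for both norms and
right multiplication by `ω(y, y⁻¹x)` is contractive, so the `A`-norm of the integrand of `Φ * Ψ` is
at most `C (‖Φ(y)‖_A ‖Ψ(y⁻¹x)‖_B + ‖Φ(y)‖_B ‖Ψ(y⁻¹x)‖_A)`. Both terms are integrands of scalar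
convolutions; Tonelli and left invariance turn their integrals into products of `L¹` norms, and the
same `C` works (`norm_L1_mul_le`).

Inverse-closedness holds for every dense differential subalgebra. If `‖ι a‖ < 1`, splitting powers
of `a` into two halves shows that their `A`-norms also decay geometrically, so the Neumann series
converges in `A`. An inverse in `B` is approximated from `A`, and Neumann series correct the
approximation to an inverse in `A`. If `A` has no identity, then neither has `B`, for `A` would
contain it as the sum of a series `Σ (e - c)^n c` (`exists_map_eq_identity`); the same correction is
then made in the unitizations.

The Banach `*`-algebra axioms integrate fibrewise identities for `a α_p(b) ω(p, q)` and `ω(p, p⁻¹)^*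
α_p(a^*)`, which encode the cocycle and twist relations. The analytic difficulty is that `G` need be
neither second countable nor `σ`-compact. Integrable functions vanish off an open `σ`-compact
subgroup (`exists_subgroup_of_lintegral_ne_top`), where Haar measure is `σ`-finite and strongly
Borel maps are strongly measurable. Since `ω` is Borel only for the Borel `σ`-algebra of `G × G`,
possibly larger than the product one, Fubini's theorem is derived for that `σ`-algebra from inner
regularity (`BorelProd.bind_fiberKernel_eq`). The involution is isometric by the change of variables
`lintegral_modularCharacterFun_mul_inv`. -/

open Filter Topology

set_option linter.unusedSectionVars false

/-! ### Inverse-closedness of dense differential subalgebras -/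

/-- A nonnegative sequence whose increments are controlled by products of earlier terms with a
geometric sequence is bounded, and its increments decay geometrically. -/
theorem exists_geometric_bound_of_split {a d : ℕ → ℝ} {r K : ℝ} (hr : 0 < r) (hr1 : r < 1)
    (hK : 0 ≤ K) (ha0 : ∀ n, 0 ≤ a n) (ha : ∀ n, a (n + 1) ≤ a n + d n)
    (hd : ∀ p q, d (p + q) ≤ K * (a p * (r ^ 2) ^ q + (r ^ 2) ^ p * a q)) :
    ∃ M, ∀ n, d n ≤ M * r ^ n := by
  -- Split `n` into two halves: the factor `(r ^ 2) ^ (n / 2)` is about `r ^ n`, and the loss for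
  -- odd `n` is the factor `r⁻¹`.
  have hstep : ∀ (M : ℝ) (n : ℕ), (∀ j ≤ n, a j ≤ M) → d n ≤ M * (2 * K * r⁻¹ * r ^ n) := by
    intro M n hM
    have hM0 : 0 ≤ M := (ha0 0).trans (hM 0 n.zero_le)
    have hr2 : r ^ 2 ≤ 1 := by nlinarith
    obtain ⟨k, hk | hk⟩ := Nat.even_or_odd' n
    · have h := hd k k
      have hk' : k + k = n := by omega
      rw [hk'] at h
      have hak := hM k (by omega)
      have e : (r ^ 2) ^ k = r ^ n := by rw [← pow_mul, hk]
      rw [e] at h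
      have hrn : 0 < r ^ n := pow_pos hr n
      calc d n ≤ K * (a k * r ^ n + r ^ n * a k) := h
        _ ≤ K * (M * r ^ n + r ^ n * M) := by gcongr
        _ = M * (2 * K * 1 * r ^ n) := by ring
        _ ≤ M * (2 * K * r⁻¹ * r ^ n) := by
          gcongr
          exact (one_le_inv₀ hr).2 hr1.le
    · have h := hd k (k + 1)
      have hk' : k + (k + 1) = n := by omega
      rw [hk'] at h
      have hak := hM k (by omega)
      have hak' := hM (k + 1) (by omega)
      have e : (r ^ 2) ^ k = r⁻¹ * r ^ n := by
        rw [← pow_mul, hk, pow_succ]; field_simp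
      have e' : (r ^ 2) ^ (k + 1) ≤ (r ^ 2) ^ k :=
        pow_le_pow_of_le_one (by positivity) hr2 (Nat.le_succ k)
      calc d n ≤ K * (a k * (r ^ 2) ^ (k + 1) + (r ^ 2) ^ k * a (k + 1)) := h
        _ ≤ K * (M * (r ^ 2) ^ k + (r ^ 2) ^ k * M) := by gcongr
        _ = M * (2 * K * r⁻¹ * r ^ n) := by rw [e]; ring
  have hsum : Summable fun n => 2 * K * r⁻¹ * r ^ n :=
    (summable_geometric_of_lt_one hr.le hr1).mul_left _
  have he0 : ∀ n, 0 ≤ 2 * K * r⁻¹ * r ^ n := fun n => by positivity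
  obtain ⟨n0, hn0⟩ := ((tendsto_sum_nat_add fun n => 2 * K * r⁻¹ * r ^ n).eventually
    (ge_mem_nhds (show (0 : ℝ) < 1 / 2 by norm_num))).exists
  -- Beyond `n0` the increments sum to at most `M / 2` as long as earlier terms are at most `M`, and
  -- the terms up to `n0` are at most `M / 2`; so the bound `M` reproduces itself by induction.
  set M : ℝ := 2 * ∑ j ∈ Finset.range (n0 + 1), a j with hMdef
  have hsmall : ∀ j ≤ n0, a j ≤ M / 2 := by
    intro j hj
    have := Finset.single_le_sum (f := a) (fun i _ => ha0 i)
      (Finset.mem_range.2 (Nat.lt_succ_of_le hj))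
    linarith
  have hM0 : 0 ≤ M := by have := (ha0 0).trans (hsmall 0 (Nat.zero_le _)); linarith
  have hbd : ∀ n, ∀ j ≤ n, a j ≤ M := by
    intro n
    induction n with
    | zero =>
      intro j hj
      have := hsmall j (by omega)
      linarith
    | succ n ih =>
      intro j hj
      rcases Nat.lt_or_ge j (n + 1) with h | h
      · exact ih j (by omega)
      obtain rfl : j = n + 1 := by omega
      by_cases hn : n + 1 ≤ n0
      · have := hsmall _ hn
        linarith
      have htel : ∀ m, n0 + m ≤ n + 1 → a (n0 + m) ≤
          a n0 + M * ∑ k ∈ Finset.range m, 2 * K * r⁻¹ * r ^ (k + n0) := by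
        intro m
        induction m with
        | zero => simp
        | succ m ihm =>
          intro hm
          have h1 := ihm (by omega)
          have h2 := ha (n0 + m)
          have h3 := hstep M (n0 + m) (fun j hj => ih j (by omega))
          rw [Finset.sum_range_succ, mul_add, add_comm m n0]
          have : n0 + (m + 1) = n0 + m + 1 := by omega
          rw [this]
          linarith
      obtain ⟨m, hm⟩ := Nat.exists_eq_add_of_le (show n0 ≤ n + 1 by omega)
      have h1 := htel m hm.ge
      rw [← hm] at h1
      have h2 : ∑ k ∈ Finset.range m, 2 * K * r⁻¹ * r ^ (k + n0) ≤ 1 / 2 := by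
        refine le_trans (Summable.sum_le_tsum _ (fun i _ => he0 _) ?_) hn0
        exact (summable_nat_add_iff n0).2 hsum
      have h3 := hsmall n0 le_rfl
      nlinarith
  refine ⟨M * (2 * K * r⁻¹), fun n => (hstep M n (hbd n)).trans_eq (by ring)⟩

/-- The power `a ^ (n + 1)` in a non-unital algebra. -/
def posPow {A : Type*} [Mul A] (a : A) : ℕ → A
  | 0 => a
  | n + 1 => a * posPow a n

section

variable {A B : Type*} [NonUnitalNormedRing A] [NormedSpace ℂ A]
  [NonUnitalNormedRing B] [NormedSpace ℂ B]

theorem posPow_mul_posPow {A : Type*} [Semigroup A] (a : A) (p q : ℕ) :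
    posPow a p * posPow a q = posPow a (p + q + 1) := by
  induction p with
  | zero => simp [posPow]
  | succ p ih =>
    have : p + 1 + q + 1 = (p + q + 1) + 1 := by omega
    rw [this, posPow, posPow, mul_assoc, ih]

theorem exists_sq_bound {δ : ℝ} (hδ : δ < 1) : ∃ r : ℝ, 0 < r ∧ r < 1 ∧ δ ≤ r ^ 2 := by
  -- The maximum with `1 / 2` keeps `r` positive when `δ` is not.
  refine ⟨√(max δ (1 / 2)), Real.sqrt_pos.2 (by positivity), ?_, ?_⟩
  · rw [Real.sqrt_lt' one_pos]
    simpa using And.intro hδ (by norm_num : (2 : ℝ)⁻¹ < 1)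
  · rw [Real.sq_sqrt (by positivity)]
    exact le_max_left _ _

/-- An element of a differential subalgebra of norm less than one in the large algebra is
quasi-invertible in the small one. -/
theorem exists_quasiInverse_of_norm_lt_one [CompleteSpace A] (ι : A →L[ℂ] B)
    (hmul : ∀ a b : A, ι (a * b) = ι a * ι b) {C : ℝ} (hC : 0 < C)
    (hdiff : ∀ a b : A, ‖a * b‖ ≤ C * (‖a‖ * ‖ι b‖ + ‖ι a‖ * ‖b‖)) {a : A} (ha : ‖ι a‖ < 1) :
    ∃ s : A, s = a + a * s ∧ s = a + s * a := by
  obtain ⟨r, hr, hr1, har⟩ := exists_sq_bound ha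
  have hι : ∀ n, ‖ι (posPow a n)‖ ≤ (r ^ 2) ^ n := by
    have : ∀ n, ‖ι (posPow a n)‖ ≤ (r ^ 2) ^ (n + 1) := by
      intro n
      induction n with
      | zero => simpa [posPow] using har
      | succ n ih =>
        rw [posPow, hmul, pow_succ' _ (n + 1)]
        exact (norm_mul_le _ _).trans (mul_le_mul har ih (norm_nonneg _) (by positivity))
    intro n
    exact (this n).trans (pow_le_pow_of_le_one (by positivity) (by nlinarith) (Nat.le_succ n))
  -- The increment is taken to be the next term itself. Since `posPow a n` has exponent `n + 1`, the
  -- product of the terms `p` and `q` has index `p + q + 1`, which is exactly `d (p + q)`.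
  obtain ⟨M, hM⟩ := exists_geometric_bound_of_split (a := fun n => ‖posPow a n‖)
    (d := fun n => ‖posPow a (n + 1)‖) hr hr1 hC.le (fun _ => norm_nonneg _)
    (fun n => le_add_of_nonneg_left (norm_nonneg _)) (fun p q => by
      rw [← posPow_mul_posPow]
      refine (hdiff _ _).trans ?_
      gcongr
      · exact hι q
      · exact hι p)
  have hs' : Summable fun n => posPow a (n + 1) :=
    Summable.of_norm_bounded ((summable_geometric_of_lt_one hr.le hr1).mul_left M) hM
  have hs : Summable (posPow a) := (summable_nat_add_iff 1).1 hs'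
  have h0 : ∑' n, posPow a n = a + ∑' n, posPow a (n + 1) := by
    rw [hs.tsum_eq_zero_add]; rfl
  refine ⟨∑' n, posPow a n, ?_, ?_⟩
  · conv_lhs => rw [h0]
    rw [← hs.tsum_mul_left]
    rfl
  · conv_lhs => rw [h0]
    rw [← hs.tsum_mul_right]
    congr 1
    refine tsum_congr fun n => ?_
    exact (posPow_mul_posPow a n 0).symm

/-- A dense differential subalgebra of an algebra with an identity contains the identity. -/
theorem exists_map_eq_identity [CompleteSpace A] (ι : A →L[ℂ] B)
    (hinj : Function.Injective ι)
    (hmul : ∀ a b : A, ι (a * b) = ι a * ι b) {C : ℝ} (hC : 0 < C)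
    (hdiff : ∀ a b : A, ‖a * b‖ ≤ C * (‖a‖ * ‖ι b‖ + ‖ι a‖ * ‖b‖)) (hdense : DenseRange ι)
    {e : B} (he : IsIdentity e) : ∃ s : A, ι s = e := by
  obtain ⟨c, hc⟩ := hdense.exists_dist_lt e (show (0 : ℝ) < 1 by norm_num)
  rw [dist_eq_norm] at hc
  obtain ⟨r, hr, hr1, hcr⟩ := exists_sq_bound hc
  -- `x n` stands for `(e - c) ^ n * c`, written without `e`. The sum of the `x n` is formally `c⁻¹
  -- c = e`.
  let x : ℕ → A := fun n => Nat.rec c (fun _ y => y - c * y) n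
  have hx0 : x 0 = c := rfl
  have hx : ∀ n, x (n + 1) = x n - c * x n := fun n => rfl
  have hxx : ∀ p q, x p * x q = c * x (p + q) := by
    intro p q
    induction p with
    | zero => simp [hx0]
    | succ p ih =>
      have : p + 1 + q = (p + q) + 1 := by omega
      rw [this, hx, hx, sub_mul, mul_assoc, ih, mul_sub]
  have hιx : ∀ n, ‖ι (x n)‖ ≤ (r ^ 2) ^ n * ‖ι c‖ := by
    intro n
    induction n with
    | zero => simp [hx0]
    | succ n ih =>
      have : ι (x (n + 1)) = (e - ι c) * ι (x n) := by
        rw [hx, map_sub, hmul, sub_mul, (he _).1]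
      rw [this, pow_succ', mul_assoc]
      exact (norm_mul_le _ _).trans (mul_le_mul hcr ih (norm_nonneg _) (by positivity))
  obtain ⟨M, hM⟩ := exists_geometric_bound_of_split (a := fun n => ‖x n‖)
    (d := fun n => ‖x (n + 1) - x n‖) (K := C * ‖ι c‖) hr hr1 (by positivity)
    (fun _ => norm_nonneg _)
    (fun n => by simpa using norm_add_le (x n) (x (n + 1) - x n)) (fun p q => by
      -- The increment is itself a product of two earlier terms, so the differential inequality
      -- splits it.
      have : x (p + q + 1) - x (p + q) = -(x p * x q) := by rw [hxx, hx]; abel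
      rw [this, norm_neg]
      refine (hdiff _ _).trans ?_
      calc C * (‖x p‖ * ‖ι (x q)‖ + ‖ι (x p)‖ * ‖x q‖)
          ≤ C * (‖x p‖ * ((r ^ 2) ^ q * ‖ι c‖) + ((r ^ 2) ^ p * ‖ι c‖) * ‖x q‖) := by
            gcongr
            · exact hιx q
            · exact hιx p
        _ = _ := by ring)
  have hdist : ∀ n, dist (x n) (x (n + 1)) ≤ M * r ^ n := fun n => by
    rw [dist_comm, dist_eq_norm]; exact hM n
  obtain ⟨l, hl⟩ := cauchySeq_tendsto_of_complete (cauchySeq_of_le_geometric r M hr1 hdist)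
  -- The limit exists in `A`, but that it vanishes is seen only in `B`, and is carried back by
  -- injectivity. The geometric distance to the limit then makes the series summable.
  have hl0 : l = 0 := by
    apply hinj
    rw [map_zero]
    refine tendsto_nhds_unique ((ι.continuous.tendsto l).comp hl) ?_
    refine squeeze_zero_norm hιx ?_
    simpa using (tendsto_pow_atTop_nhds_zero_of_lt_one (sq_nonneg r)
      (by nlinarith : r ^ 2 < 1)).mul_const ‖ι c‖
  have hs : Summable x := by
    refine Summable.of_norm_bounded (g := fun n => M / (1 - r) * r ^ n)
      ((summable_geometric_of_lt_one hr.le hr1).mul_left _) fun n => ?_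
    have := dist_le_of_le_geometric_of_tendsto r M hr1 hdist hl n
    rw [hl0, dist_zero_right] at this
    exact this.trans_eq (by ring)
  have h1 : c * ∑' n, x n = c := by
    have h2 : ∑' n, x (n + 1) = ∑' n, x n - c * ∑' n, x n := by
      rw [← hs.tsum_mul_left, ← hs.tsum_sub (hs.mul_left c)]
    have h3 := hs.tsum_eq_zero_add
    rw [h2, hx0] at h3
    have h4 : c * ∑' n, x n - c = 0 := by
      rw [← sub_eq_zero] at h3
      rw [← h3]; abel
    exact sub_eq_zero.1 h4
  refine ⟨∑' n, x n, ?_⟩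
  set s := ∑' n, x n
  -- As `c * s = c`, the defect `e - ι s` is fixed by left multiplication with an element of norm
  -- below one, hence is zero.
  have h5 : e - ι s = (e - ι c) * (e - ι s) := by
    rw [sub_mul, (he _).1, mul_sub, (he _).2, ← hmul, h1, sub_self, sub_zero]
  have h6 : ‖e - ι s‖ ≤ ‖e - ι c‖ * ‖e - ι s‖ := by
    conv_lhs => rw [h5]
    exact norm_mul_le _ _
  have h7 : ‖e - ι s‖ = 0 := by
    by_contra h
    have : 0 < ‖e - ι s‖ := lt_of_le_of_ne (norm_nonneg _) (Ne.symm h)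
    nlinarith
  exact (sub_eq_zero.1 (norm_eq_zero.1 h7)).symm

/-! ### Spectra with and without identity, and inverse-closedness -/

theorem IsIdentity.eq {M : Type*} [Mul M] {e f : M} (he : IsIdentity e) (hf : IsIdentity f) :
    e = f := by
  rw [← (hf e).1, (he f).2]

theorem algSpectrum_eq_of_isIdentity {A : Type*} [NormedAddCommGroup A] [NormedSpace ℂ A] [Mul A]
    {e : A} (he : IsIdentity e) (a : A) :
    algSpectrum a = {z | ¬ ∃ b : A, (z • e - a) * b = e ∧ b * (z • e - a) = e} := by
  ext z
  refine ⟨fun h => h.1 e he, fun h => ⟨fun e' he' => ?_, fun h' => (h' ⟨e, he⟩).elim⟩⟩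
  rwa [he'.eq he]

theorem Unitization.fst_inl_sub_inr {A : Type*} [AddGroup A] (z : ℂ) (a : A) :
    ((Unitization.inl z : Unitization ℂ A) - (a : Unitization ℂ A)).fst = z :=
  sub_zero z

theorem Unitization.snd_inl_sub_inr {A : Type*} [AddGroup A] (z : ℂ) (a : A) :
    ((Unitization.inl z : Unitization ℂ A) - (a : Unitization ℂ A)).snd = -a :=
  zero_sub a

/-- The scalar coordinate of `(z - a) u = 1` forces `z ≠ 0` and `u = z⁻¹ + b`; the two equations for
`b` are the remaining coordinates of `(z - a) u = 1` and `u (z - a) = 1`. -/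
theorem algSpectrum_eq_of_not_exists_isIdentity {A : Type*} [NonUnitalNormedRing A]
    [NormedSpace ℂ A] [IsScalarTower ℂ A A] [SMulCommClass ℂ A A]
    (h : ¬ ∃ e : A, IsIdentity e) (a : A) :
    algSpectrum a = {z | ¬ (z ≠ 0 ∧ ∃ b : A, z • b - z⁻¹ • a = a * b ∧
      z • b - z⁻¹ • a = b * a)} := by
  ext z
  have key : (∃ u : Unitization ℂ A,
      ((Unitization.inl z : Unitization ℂ A) - (a : Unitization ℂ A)) * u = 1 ∧
      u * ((Unitization.inl z : Unitization ℂ A) - (a : Unitization ℂ A)) = 1) ↔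
      (z ≠ 0 ∧ ∃ b : A, z • b - z⁻¹ • a = a * b ∧ z • b - z⁻¹ • a = b * a) := by
    constructor
    · rintro ⟨u, h1, h2⟩
      have h1f := congrArg (fun t : Unitization ℂ A => t.fst) h1
      have h1s := congrArg (fun t : Unitization ℂ A => t.snd) h1
      have h2s := congrArg (fun t : Unitization ℂ A => t.snd) h2
      simp only [Unitization.fst_mul, Unitization.snd_mul, Unitization.fst_inl_sub_inr,
        Unitization.snd_inl_sub_inr, Unitization.fst_one, Unitization.snd_one] at h1f h1s h2s
      have hz : z ≠ 0 := left_ne_zero_of_mul (h1f ▸ one_ne_zero)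
      have hu : u.fst = z⁻¹ := eq_inv_of_mul_eq_one_right h1f
      rw [hu] at h1s h2s
      refine ⟨hz, u.snd, ?_, ?_⟩
      · rw [← sub_eq_zero, ← h1s, smul_neg, neg_mul]; abel
      · rw [← sub_eq_zero, ← h2s, smul_neg, mul_neg]; abel
    · rintro ⟨hz, b, h1, h2⟩
      refine ⟨Unitization.inl z⁻¹ + (b : Unitization ℂ A), ?_, ?_⟩
      · ext
        · simp [Unitization.fst_inl_sub_inr, hz]
        · simp only [Unitization.snd_mul, Unitization.fst_inl_sub_inr,
            Unitization.snd_inl_sub_inr, Unitization.fst_add, Unitization.snd_add,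
            Unitization.fst_inl, Unitization.fst_inr, Unitization.snd_inl, Unitization.snd_inr,
            Unitization.snd_one, zero_add, add_zero, smul_neg, neg_mul, ← h1]
          abel
      · ext
        · simp [Unitization.fst_inl_sub_inr, hz]
        · simp only [Unitization.snd_mul, Unitization.fst_inl_sub_inr,
            Unitization.snd_inl_sub_inr, Unitization.fst_add, Unitization.snd_add,
            Unitization.fst_inl, Unitization.fst_inr, Unitization.snd_inl, Unitization.snd_inr,
            Unitization.snd_one, zero_add, add_zero, smul_neg, mul_neg, ← h2]
          abel
  exact ⟨fun hz h' => hz.2 h (key.2 h'), fun hz => ⟨fun e he => (h ⟨e, he⟩).elim,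
    fun _ h' => hz (key.1 h')⟩⟩

/-- One-sided inverses, obtained from an approximate inverse and quasi-inverses. -/
theorem exists_inverse_of_quasiInverse {A : Type*} [NonUnitalRing A] {e g b s t : A}
    (he : IsIdentity e) (hs : s = (e - g * b) + (e - g * b) * s)
    (ht : t = (e - b * g) + t * (e - b * g)) : ∃ c, g * c = e ∧ c * g = e := by
  have h1 : g * (b * (e + s)) = e := by
    have h : s = e - g * b + (s - g * b * s) := by
      conv_lhs => rw [hs]
      rw [sub_mul, (he _).1]
    have h' : g * b + g * b * s = e := by
      have : s - s = e - (g * b + g * b * s) := by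
        conv_lhs => arg 1; rw [h]
        abel
      rw [sub_self] at this
      exact (sub_eq_zero.1 this.symm).symm
    rw [← mul_assoc, mul_add, (he _).2, h']
  have h2 : ((e + t) * b) * g = e := by
    have h : t = e - b * g + (t - t * (b * g)) := by
      conv_lhs => rw [ht]
      rw [mul_sub, (he _).2]
    have h' : b * g + t * (b * g) = e := by
      have : t - t = e - (b * g + t * (b * g)) := by
        conv_lhs => arg 1; rw [h]
        abel
      rw [sub_self] at this
      exact (sub_eq_zero.1 this.symm).symm
    rw [mul_assoc, add_mul, (he _).1, h']
  have h3 : b * (e + s) = (e + t) * b := by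
    calc b * (e + s) = e * (b * (e + s)) := ((he _).1).symm
      _ = ((e + t) * b * g) * (b * (e + s)) := by rw [h2]
      _ = (e + t) * b := by rw [mul_assoc, h1, (he _).2]
  exact ⟨b * (e + s), h1, by rw [h3, h2]⟩

/-- An inverse in `B` is approximated by some `b` in `A` so well that both products with the given
element are within distance one of the identity in the norm of `B`. Quasi-inverses of the two
defects, which exist in `A`, correct `b` to a right and a left inverse in `A`. -/
theorem isInverseClosed_of_norm_mul_le [IsScalarTower ℂ A A] [SMulCommClass ℂ A A]
    [IsScalarTower ℂ B B] [SMulCommClass ℂ B B] [CompleteSpace A] (ι : A →L[ℂ] B)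
    (hinj : Function.Injective ι) (hmul : ∀ a b : A, ι (a * b) = ι a * ι b)
    (hid : ∀ e : A, IsIdentity e → IsIdentity (ι e)) {C : ℝ} (hC : 0 < C)
    (hdiff : ∀ a b : A, ‖a * b‖ ≤ C * (‖a‖ * ‖ι b‖ + ‖ι a‖ * ‖b‖)) (hdense : DenseRange ι) :
    IsInverseClosed ι := by
  intro a
  by_cases hA : ∃ e : A, IsIdentity e
  · obtain ⟨e, he⟩ := hA
    rw [algSpectrum_eq_of_isIdentity he, algSpectrum_eq_of_isIdentity (hid e he)]
    ext z
    refine not_congr ⟨?_, ?_⟩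
    · rintro ⟨b, h1, h2⟩
      refine ⟨ι b, ?_, ?_⟩
      · rw [← map_smul, ← map_sub, ← hmul, h1]
      · rw [← map_smul, ← map_sub, ← hmul, h2]
    · rintro ⟨b', h1, h2⟩
      set g := z • e - a with hg
      have hιg : z • ι e - ι a = ι g := by rw [hg, map_sub, map_smul]
      rw [hιg] at h1 h2
      have hopen : IsOpen {y : B | ‖ι e - ι g * y‖ < 1 ∧ ‖ι e - y * ι g‖ < 1} :=
        IsOpen.and (isOpen_lt (by fun_prop) (by fun_prop)) (isOpen_lt (by fun_prop) (by fun_prop))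
      obtain ⟨b, hb1, hb2⟩ := hdense.exists_mem_open hopen ⟨b', by simp [h1, h2]⟩
      rw [← hmul, ← map_sub] at hb1 hb2
      obtain ⟨s, hs, -⟩ := exists_quasiInverse_of_norm_lt_one ι hmul hC hdiff hb1
      obtain ⟨t, -, ht⟩ := exists_quasiInverse_of_norm_lt_one ι hmul hC hdiff hb2
      exact exists_inverse_of_quasiInverse he hs ht
  · have hB : ¬ ∃ e : B, IsIdentity e := by
      rintro ⟨e, he⟩
      obtain ⟨s, hs⟩ := exists_map_eq_identity ι hinj hmul hC hdiff hdense he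
      refine hA ⟨s, fun x => ⟨hinj ?_, hinj ?_⟩⟩
      · rw [hmul, hs, (he _).1]
      · rw [hmul, hs, (he _).2]
    rw [algSpectrum_eq_of_not_exists_isIdentity hA, algSpectrum_eq_of_not_exists_isIdentity hB]
    ext z
    refine not_congr (and_congr_right fun hz => ⟨?_, ?_⟩)
    · rintro ⟨b, h1, h2⟩
      refine ⟨ι b, ?_, ?_⟩
      · rw [← hmul, ← h1, map_sub, map_smul, map_smul]
      · rw [← hmul, ← h2, map_sub, map_smul, map_smul]
    · rintro ⟨b', h1, h2⟩
      have hopen : IsOpen {y : B | ‖z⁻¹ • ι a + ι a * y - z • y‖ < 1 ∧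
          ‖z⁻¹ • ι a + y * ι a - z • y‖ < 1} :=
        IsOpen.and (isOpen_lt (by fun_prop) (by fun_prop)) (isOpen_lt (by fun_prop) (by fun_prop))
      obtain ⟨b, hb1, hb2⟩ := hdense.exists_mem_open hopen ⟨b', by simp [← h1, ← h2]⟩
      rw [← hmul, ← map_smul, ← map_smul, ← map_add, ← map_sub] at hb1 hb2
      obtain ⟨s, hs, -⟩ := exists_quasiInverse_of_norm_lt_one ι hmul hC hdiff hb1
      obtain ⟨t, -, ht⟩ := exists_quasiInverse_of_norm_lt_one ι hmul hC hdiff hb2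
      -- In the unitization `(z - a)(z⁻¹ + b) = 1 - k` with `k = z⁻¹ a + a b - z b`, and `1 + s` is
      -- a right inverse of `1 - k`. The witness is the `A`-coordinate of `(z⁻¹ + b)(1 + s)`; on the
      -- other side it is that of `(1 + t)(z⁻¹ + b)`.
      have h1' : z • (b + z⁻¹ • s + b * s) - z⁻¹ • a = a * (b + z⁻¹ • s + b * s) := by
        rw [sub_mul, add_mul, smul_mul_assoc, smul_mul_assoc, mul_assoc] at hs
        rw [smul_add, smul_add, smul_smul, mul_inv_cancel₀ hz, one_smul, mul_add, mul_add,
          mul_smul_comm]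
        conv_lhs => arg 1; arg 1; arg 2; rw [hs]
        abel
      have h2' : z • (b + z⁻¹ • t + t * b) - z⁻¹ • a = (b + z⁻¹ • t + t * b) * a := by
        rw [mul_sub, mul_add, mul_smul_comm, mul_smul_comm, ← mul_assoc] at ht
        rw [smul_add, smul_add, smul_smul, mul_inv_cancel₀ hz, one_smul, add_mul, add_mul,
          smul_mul_assoc]
        conv_lhs => arg 1; arg 1; arg 2; rw [ht]
        abel
      set c := b + z⁻¹ • s + b * s
      set d := b + z⁻¹ • t + t * b
      -- A right and a left inverse agree: computing `d * a * c` in two ways gives `d * a = a * c`,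
      -- hence `z • c = z • d`.
      have hcd : c = d := by
        have e1 : d * (z • c - z⁻¹ • a) = (z • d - z⁻¹ • a) * c := by
          rw [h1', h2', mul_assoc]
        rw [mul_sub, sub_mul, mul_smul_comm, smul_mul_assoc, mul_smul_comm, smul_mul_assoc,
          sub_right_inj] at e1
        have e2 : d * a = a * c := smul_right_injective A (inv_ne_zero hz) e1
        rw [← h1', ← h2', sub_left_inj] at e2
        exact (smul_right_injective A hz e2).symm
      exact ⟨c, h1', by conv_rhs => rw [hcd, ← h2', ← hcd]⟩

end

/-- The non-unital normed ring structure underlying a Banach `*`-algebra. -/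
abbrev IsBanachStarAlgebra.toNonUnitalNormedRing {A : Type*} [i : NormedAddCommGroup A]
    [NormedSpace ℂ A] [Mul A] [Star A] (h : IsBanachStarAlgebra A) : NonUnitalNormedRing A where
  toNorm := i.toNorm
  toMetricSpace := i.toMetricSpace
  toAddCommGroup := i.toAddCommGroup
  dist_eq := i.dist_eq
  mul := (· * ·)
  left_distrib := h.mul_add
  right_distrib := h.add_mul
  zero_mul a := by simpa using h.smul_mul 0 0 a
  mul_zero a := by simpa using h.mul_smul 0 a 0
  mul_assoc := h.mul_assoc
  norm_mul_le := h.norm_mul_le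

/-- A dense differential subalgebra is inverse-closed. -/
theorem IsDifferentialSubalgebra.isInverseClosed {A B : Type*}
    [NormedAddCommGroup A] [NormedSpace ℂ A] [Mul A] [Star A]
    [NormedAddCommGroup B] [NormedSpace ℂ B] [Mul B] [Star B] {ι : A →L[ℂ] B}
    (h : IsDifferentialSubalgebra ι) (hdense : DenseRange ι) : IsInverseClosed ι := by
  obtain ⟨C, hC, hdiff⟩ := h.norm_mul_le
  let := h.banach_left.toNonUnitalNormedRing
  let := h.banach_right.toNonUnitalNormedRing
  have := h.banach_left.complete
  have : IsScalarTower ℂ A A := ⟨h.banach_left.smul_mul⟩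
  have : SMulCommClass ℂ A A := ⟨fun z a b => (h.banach_left.mul_smul z a b).symm⟩
  have : IsScalarTower ℂ B B := ⟨h.banach_right.smul_mul⟩
  have : SMulCommClass ℂ B B := ⟨fun z a b => (h.banach_right.mul_smul z a b).symm⟩
  exact isInverseClosed_of_norm_mul_le ι h.injective h.map_mul h.map_identity hC hdiff hdense

/-! ### Fubini's theorem for the Borel `σ`-algebra of a product -/

section BorelProd

open Set ProbabilityTheory
open scoped ENNReal

/-- The product of two topological spaces, with the Borel `σ`-algebra of the product topology
(in general larger than the product of the Borel `σ`-algebras). -/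
def BorelProd (X Y : Type*) := X × Y

namespace BorelProd

theorem integral_bind_kernel {X Y E : Type*} [MeasurableSpace X] [MeasurableSpace Y]
    [NormedAddCommGroup E] [NormedSpace ℝ E] {m : Measure X} [SFinite m] {κ : Kernel X Y}
    {f : Y → E} (hf : Integrable f (m.bind κ)) :
    ∫ y, f y ∂(m.bind κ) = ∫ x, ∫ y, f y ∂(κ x) ∂m := by
  rw [Measure.comp_eq_comp_const_apply] at hf ⊢
  rw [Kernel.integral_comp hf, Kernel.const_apply]

variable {X Y : Type*} [TopologicalSpace X] [TopologicalSpace Y]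

instance : TopologicalSpace (BorelProd X Y) := inferInstanceAs (TopologicalSpace (X × Y))

instance : MeasurableSpace (BorelProd X Y) := borel _

instance : BorelSpace (BorelProd X Y) := ⟨rfl⟩

/-- The pair `(x, y)`. -/
def mk (x : X) (y : Y) : BorelProd X Y := (x, y)

/-- The first coordinate. -/
def fst (z : BorelProd X Y) : X := Prod.fst z

/-- The second coordinate. -/
def snd (z : BorelProd X Y) : Y := Prod.snd z

theorem continuous_fst : Continuous (fst : BorelProd X Y → X) := _root_.continuous_fst

theorem continuous_snd : Continuous (snd : BorelProd X Y → Y) := _root_.continuous_snd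

theorem continuous_mk {Z : Type*} [TopologicalSpace Z] {f : Z → X} {g : Z → Y}
    (hf : Continuous f) (hg : Continuous g) : Continuous (fun z => mk (f z) (g z)) :=
  hf.prodMk hg

variable [MeasurableSpace X] [BorelSpace X] [MeasurableSpace Y] [BorelSpace Y]

theorem measurable_mk_left (x : X) : Measurable (fun y : Y => mk x y) :=
  (continuous_mk continuous_const continuous_id).measurable

theorem measurable_mk_right (y : Y) : Measurable (fun x : X => mk x y) :=
  (continuous_mk continuous_id continuous_const).measurable

/-- Inner regularity finds a compact part of the section of measure above `q`, and the tube lemma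
thickens it to an open box inside `E`. -/
theorem exists_isOpen_of_lt_measure {n : Measure Y} [n.InnerRegular] {E : Set (BorelProd X Y)}
    (hE : IsOpen E) {x : X} {q : ℝ≥0∞} (hq : q < n (mk x ⁻¹' E)) :
    ∃ (U : Set X) (V : Set Y), IsOpen U ∧ IsOpen V ∧ x ∈ U ∧ q < n V ∧
      ∀ x ∈ U, ∀ y ∈ V, mk x y ∈ E := by
  have ho : IsOpen (mk x ⁻¹' E) := hE.preimage (continuous_mk continuous_const continuous_id)
  obtain ⟨K, hKE, hK, hqK⟩ := ho.measurableSet.exists_lt_isCompact hq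
  obtain ⟨U, V, hU, hV, hxU, hKV, hUV⟩ := generalized_tube_lemma (s := {x}) isCompact_singleton hK
    (n := (E : Set (X × Y))) hE (by
      rintro ⟨a, b⟩ ⟨ha, hb⟩
      obtain rfl : a = x := ha
      exact hKE hb)
  refine ⟨U, V, hU, hV, hxU rfl, hqK.trans_le (measure_mono hKV), fun a ha b hb => hUV ⟨ha, hb⟩⟩

/-- For open `E` the measure of the section is lower semicontinuous in `x`, by the boxes of
`exists_isOpen_of_lt_measure`. Borel sets follow by a π-λ argument, where finiteness handles
complements. -/
theorem measurable_measure_section_of_isFiniteMeasure {n : Measure Y} [IsFiniteMeasure n]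
    [n.InnerRegular] {E : Set (BorelProd X Y)} (hE : MeasurableSet E) :
    Measurable fun x => n (mk x ⁻¹' E) := by
  induction E, hE using MeasurableSpace.induction_on_inter
    (rfl : _ = MeasurableSpace.generateFrom {s | IsOpen s}) isPiSystem_isOpen with
  | empty => simp
  | basic E hE =>
    refine measurable_of_Ioi fun q => IsOpen.measurableSet ?_
    refine isOpen_iff_forall_mem_open.2 fun x hx => ?_
    obtain ⟨U, V, hU, -, hxU, hq, hUV⟩ := exists_isOpen_of_lt_measure hE hx
    exact ⟨U, fun a ha => lt_of_lt_of_le hq (measure_mono fun b hb => hUV a ha b hb), hU, hxU⟩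
  | compl E hE ih =>
    have : (fun x => n (mk x ⁻¹' Eᶜ)) = fun x => n univ - n (mk x ⁻¹' E) := by
      ext x
      rw [preimage_compl, measure_compl (measurable_mk_left x hE) (measure_ne_top _ _)]
    rw [this]
    exact ih.const_sub _
  | iUnion f hd hm ih =>
    have : (fun x => n (mk x ⁻¹' ⋃ i, f i)) = fun x => ∑' i, n (mk x ⁻¹' f i) := by
      ext x
      rw [preimage_iUnion, measure_iUnion (fun i j hij => (hd hij).preimage _)
        (fun i => measurable_mk_left x (hm i))]
    rw [this]
    exact Measurable.tsum ih

/-- A compact subset is covered by finitely many of the null neighbourhoods, so it is null; inner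
regularity does the rest. -/
theorem measure_eq_zero_of_forall_exists_isOpen {m : Measure X} [IsFiniteMeasure m]
    [m.InnerRegular] {A S : Set X} (hS : MeasurableSet S)
    (hA : MeasurableSet A) (h : ∀ x ∈ A, ∃ U, IsOpen U ∧ x ∈ U ∧ m (U ∩ S) = 0) :
    m (A ∩ S) = 0 := by
  by_contra hne
  obtain ⟨K, hKA, hK, hK0⟩ := (hA.inter hS).exists_lt_isCompact (pos_iff_ne_zero.2 hne)
  refine hK0.ne' (hK.measure_zero_of_nhdsWithin fun x hx => ?_)
  obtain ⟨U, hU, hxU, hU0⟩ := h x (hKA hx).1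
  refine ⟨U ∩ K, inter_mem (mem_nhdsWithin_of_mem_nhds (hU.mem_nhds hxU)) self_mem_nhdsWithin,
    measure_mono_null (inter_subset_inter_right U (hKA.trans inter_subset_right)) hU0⟩

/-- `F` is the union of a sequence whose measures approach the supremum; adjoining `R` cannot exceed
that supremum. Here measurability refers to the product `σ`-algebra, which open sets need not belong
to. -/
theorem exists_maximal_isOpen_measurableSet (ρ : Measure (X × Y)) [IsFiniteMeasure ρ]
    (E : Set (X × Y)) : ∃ F ⊆ E, IsOpen F ∧ MeasurableSet F ∧
      ∀ R ⊆ E, IsOpen R → MeasurableSet R → ρ (R \ F) = 0 := by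
  set S : Set ℝ≥0∞ := ρ '' {F | F ⊆ E ∧ IsOpen F ∧ MeasurableSet F}
  have hne : S.Nonempty := ⟨ρ ∅, ∅, ⟨empty_subset _, isOpen_empty, MeasurableSet.empty⟩, rfl⟩
  obtain ⟨u, -, hu, huS⟩ := exists_seq_tendsto_sSup hne (OrderTop.bddAbove S)
  choose F hF hFu using huS
  refine ⟨⋃ i, F i, iUnion_subset fun i => (hF i).1, isOpen_iUnion fun i => (hF i).2.1,
    MeasurableSet.iUnion fun i => (hF i).2.2, fun R hRE hR hRm => ?_⟩
  set F' := ⋃ i, F i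
  have hF'm : MeasurableSet F' := MeasurableSet.iUnion fun i => (hF i).2.2
  have h1 : sSup S ≤ ρ F' := le_of_tendsto' hu fun i => by
    rw [← hFu]; exact measure_mono (subset_iUnion F i)
  have h2 : ρ (R ∪ F') ≤ sSup S := le_sSup ⟨R ∪ F',
    ⟨union_subset hRE (iUnion_subset fun i => (hF i).1),
      hR.union (isOpen_iUnion fun i => (hF i).2.1), hRm.union hF'm⟩, rfl⟩
  have h3 : (R ∪ F') \ F' = R \ F' := union_sdiff_right
  rw [← h3, measure_sdiff subset_union_right hF'm.nullMeasurableSet (measure_ne_top _ _)]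
  exact tsub_eq_zero_of_le (h2.trans h1)

/-- Ordinary Tonelli applies to a maximal product-measurable open `F ⊆ E`. Almost every section of
`F` has the full measure of the section of `E`: if the latter exceeds `q` at `x`, some open box `U
×ˢ V ⊆ E` with `x ∈ U` and `n V > q` lies in `F` up to a null set, so the sections of `F` have
measure above `q` almost everywhere on `U`. Such locally null exceptional sets are null. The reverse
inequality follows by exchanging the factors. -/
theorem lintegral_measure_section_le {m : Measure X} {n : Measure Y} [IsFiniteMeasure m]
    [IsFiniteMeasure n] [m.InnerRegular] [n.InnerRegular] {E : Set (BorelProd X Y)}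
    (hE : IsOpen E) :
    ∫⁻ x, n (mk x ⁻¹' E) ∂m ≤ ∫⁻ y, m ((fun x => mk x y) ⁻¹' E) ∂n := by
  obtain ⟨F, hFE, hF, hFm, hmax⟩ := exists_maximal_isOpen_measurableSet (m.prod n) E
  calc ∫⁻ x, n (mk x ⁻¹' E) ∂m ≤ ∫⁻ x, n (Prod.mk x ⁻¹' F) ∂m := ?_
    _ = ∫⁻ y, m ((fun x => (x, y)) ⁻¹' F) ∂n := by
      rw [← Measure.prod_apply hFm, Measure.prod_apply_symm hFm]
    _ ≤ ∫⁻ y, m ((fun x => mk x y) ⁻¹' E) ∂n :=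
      lintegral_mono fun y => measure_mono fun x hx => hFE hx
  refine lintegral_mono_ae ?_
  have hEm := measurable_measure_section_of_isFiniteMeasure (n := n) hE.measurableSet
  have hFm' : Measurable fun x => n (Prod.mk x ⁻¹' F) := measurable_measure_prodMk_left hFm
  have key : ∀ q : ℚ, m ({x | ENNReal.ofReal q < n (mk x ⁻¹' E)} ∩
      {x | n (Prod.mk x ⁻¹' F) ≤ ENNReal.ofReal q}) = 0 := by
    intro q
    refine measure_eq_zero_of_forall_exists_isOpen (measurableSet_le hFm' measurable_const)
      (measurableSet_lt measurable_const hEm) fun x hx => ?_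
    obtain ⟨U, V, hU, hV, hxU, hq, hUV⟩ := exists_isOpen_of_lt_measure hE hx
    refine ⟨U, hU, hxU, ?_⟩
    have h0 := hmax (U ×ˢ V) (fun p hp => hUV _ hp.1 _ hp.2) (hU.prod hV)
      (hU.measurableSet.prod hV.measurableSet)
    rw [Measure.measure_prod_null ((hU.measurableSet.prod hV.measurableSet).diff hFm)] at h0
    rw [← nonpos_iff_eq_zero, ← (ae_iff.1 h0 : _)]
    refine measure_mono fun x hx h => ?_
    have hle : V ⊆ (Prod.mk x ⁻¹' (U ×ˢ V \ F)) ∪ Prod.mk x ⁻¹' F := fun y hy => by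
      by_cases hyF : (x, y) ∈ F
      · exact Or.inr hyF
      · exact Or.inl ⟨⟨hx.1, hy⟩, hyF⟩
    have := (measure_mono hle).trans (measure_union_le (μ := n) _ _)
    rw [show n (Prod.mk x ⁻¹' (U ×ˢ V \ F)) = 0 from h, zero_add] at this
    exact absurd hq (not_lt.2 (this.trans hx.2))
  have hall : ∀ᵐ x ∂m, ∀ q : ℚ, ¬ (ENNReal.ofReal q < n (mk x ⁻¹' E) ∧
      n (Prod.mk x ⁻¹' F) ≤ ENNReal.ofReal q) := by
    refine ae_all_iff.2 fun q => ?_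
    rw [ae_iff]
    simp only [not_not]
    exact key q
  filter_upwards [hall] with x hx
  by_contra! hlt
  obtain ⟨q, -, h1, h2⟩ := ENNReal.lt_iff_exists_rat_btwn.1 hlt
  exact hx q ⟨h2, h1.le⟩

/-- The exchange of the two coordinates. -/
def swap (z : BorelProd X Y) : BorelProd Y X := mk z.snd z.fst

theorem measurable_swap : Measurable (swap : BorelProd X Y → BorelProd Y X) :=
  (continuous_mk continuous_snd continuous_fst).measurable

theorem lintegral_measure_section_swap_of_isFiniteMeasure {m : Measure X} {n : Measure Y}
    [IsFiniteMeasure m] [IsFiniteMeasure n] [m.InnerRegular] [n.InnerRegular]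
    {E : Set (BorelProd X Y)} (hE : MeasurableSet E) :
    ∫⁻ x, n (mk x ⁻¹' E) ∂m = ∫⁻ y, m ((fun x => mk x y) ⁻¹' E) ∂n := by
  have hl : ∀ {E : Set (BorelProd X Y)}, MeasurableSet E →
      Measurable fun y => m ((fun x => mk x y) ⁻¹' E) := fun hE =>
    measurable_measure_section_of_isFiniteMeasure (n := m) (measurable_swap hE)
  induction E, hE using MeasurableSpace.induction_on_inter
    (rfl : _ = MeasurableSpace.generateFrom {s | IsOpen s}) isPiSystem_isOpen with
  | empty => simp
  | basic E hE =>
    refine le_antisymm (lintegral_measure_section_le hE) ?_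
    exact lintegral_measure_section_le (m := n) (n := m)
      (hE.preimage (continuous_mk continuous_snd continuous_fst) : IsOpen (swap ⁻¹' E))
  | compl E hE ih =>
    have h1 : ∀ x, n (mk x ⁻¹' Eᶜ) = n univ - n (mk x ⁻¹' E) := fun x => by
      rw [preimage_compl, measure_compl (measurable_mk_left x hE) (measure_ne_top _ _)]
    have h2 : ∀ y, m ((fun x => mk x y) ⁻¹' Eᶜ) = m univ - m ((fun x => mk x y) ⁻¹' E) :=
      fun y => by
        rw [preimage_compl, measure_compl (measurable_mk_right y hE) (measure_ne_top _ _)]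
    have hfin : ∫⁻ x, n (mk x ⁻¹' E) ∂m ≠ ∞ :=
      ((lintegral_mono fun x => measure_mono (subset_univ _)).trans_lt
        (by simp [ENNReal.mul_lt_top])).ne
    simp_rw [h1, h2]
    rw [lintegral_sub (measurable_measure_section_of_isFiniteMeasure hE) hfin
        (ae_of_all _ fun x => measure_mono (subset_univ _)),
      lintegral_sub (hl hE) (ih ▸ hfin) (ae_of_all _ fun x => measure_mono (subset_univ _)), ih]
    simp [mul_comm]
  | iUnion f hd hm ih =>
    have h1 : ∀ x, n (mk x ⁻¹' ⋃ i, f i) = ∑' i, n (mk x ⁻¹' f i) := fun x => by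
      rw [preimage_iUnion, measure_iUnion (fun i j hij => (hd hij).preimage _)
        (fun i => measurable_mk_left x (hm i))]
    have h2 : ∀ y, m ((fun x => mk x y) ⁻¹' ⋃ i, f i) = ∑' i, m ((fun x => mk x y) ⁻¹' f i) :=
      fun y => by
        rw [preimage_iUnion, measure_iUnion (fun i j hij => (hd hij).preimage _)
          (fun i => measurable_mk_right y (hm i))]
    simp_rw [h1, h2]
    rw [lintegral_tsum fun i =>
        (measurable_measure_section_of_isFiniteMeasure (hm i)).aemeasurable,
      lintegral_tsum fun i => (hl (hm i)).aemeasurable]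
    exact tsum_congr ih

/-- Restriction to disjoint pieces of finite measure reduces `σ`-finite measures to finite inner
regular ones. -/
theorem exists_sum_eq (m : Measure X) [SigmaFinite m] [m.InnerRegularCompactLTTop] :
    ∃ p : ℕ → Measure X, (∀ i, IsFiniteMeasure (p i)) ∧ (∀ i, (p i).InnerRegular) ∧
      Measure.sum p = m := by
  have hfin : ∀ i, IsFiniteMeasure (m.restrict (disjointed (spanningSets m) i)) := fun i =>
    ⟨by
      rw [Measure.restrict_apply_univ]
      exact (measure_mono (disjointed_subset _ _)).trans_lt (measure_spanningSets_lt_top m i)⟩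
  refine ⟨fun i => m.restrict (disjointed (spanningSets m) i), hfin, fun i => ?_,
    sum_restrict_disjointed_spanningSets m m⟩
  have := hfin i
  infer_instance

variable {m : Measure X} {n : Measure Y} [SigmaFinite m] [SigmaFinite n]
  [m.InnerRegularCompactLTTop] [n.InnerRegularCompactLTTop]

theorem measurable_measure_section {n : Measure Y} [SigmaFinite n] [n.InnerRegularCompactLTTop]
    {E : Set (BorelProd X Y)} (hE : MeasurableSet E) :
    Measurable fun x => n (mk x ⁻¹' E) := by
  obtain ⟨p, hp, hp', rfl⟩ := exists_sum_eq n
  simp_rw [fun x => Measure.sum_apply p (measurable_mk_left (Y := Y) x hE)]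
  exact Measurable.tsum fun i => measurable_measure_section_of_isFiniteMeasure hE

theorem lintegral_measure_section_swap {E : Set (BorelProd X Y)} (hE : MeasurableSet E) :
    ∫⁻ x, n (mk x ⁻¹' E) ∂m = ∫⁻ y, m ((fun x => mk x y) ⁻¹' E) ∂n := by
  obtain ⟨p, hp, hp', hpm⟩ := exists_sum_eq m
  obtain ⟨q, hq, hq', hqn⟩ := exists_sum_eq n
  subst hpm hqn
  have h1 : ∀ x, Measure.sum q (mk x ⁻¹' E) = ∑' j, q j (mk x ⁻¹' E) := fun x =>
    Measure.sum_apply _ (measurable_mk_left x hE)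
  have h2 : ∀ y, Measure.sum p ((fun x => mk x y) ⁻¹' E) =
      ∑' i, p i ((fun x => mk x y) ⁻¹' E) := fun y =>
    Measure.sum_apply _ (measurable_mk_right y hE)
  simp_rw [h1, h2]
  rw [lintegral_tsum fun j => (measurable_measure_section_of_isFiniteMeasure hE).aemeasurable,
    lintegral_tsum fun i => (show Measurable fun y => p i ((fun x => mk x y) ⁻¹' E) from
      measurable_measure_section_of_isFiniteMeasure (n := p i)
        (measurable_swap hE)).aemeasurable]
  simp_rw [lintegral_sum_measure]
  rw [ENNReal.tsum_comm]
  exact tsum_congr fun i => tsum_congr fun j =>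
    lintegral_measure_section_swap_of_isFiniteMeasure hE

variable (n) in
/-- The kernel that sends `x` to the measure `n` on the fiber over `x`. -/
noncomputable def fiberKernel : Kernel X (BorelProd X Y) where
  toFun x := n.map (mk x)
  measurable' := Measure.measurable_of_measurable_coe _ fun E hE => by
    have h : (fun x => n.map (mk x) E) = fun x => n (mk x ⁻¹' E) :=
      funext fun x => Measure.map_apply (measurable_mk_left x) hE
    rw [h]
    exact measurable_measure_section hE

theorem fiberKernel_apply (x : X) : fiberKernel n x = n.map (mk x) := rfl

variable (n) in
/-- The kernel that sends `x` to the measure `n` on the fiber over `x`, with the coordinates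
exchanged. -/
noncomputable def fiberKernelSwap : Kernel X (BorelProd Y X) :=
  (fiberKernel n).map swap

theorem fiberKernelSwap_apply (x : X) :
    fiberKernelSwap n x = n.map (fun y => mk y x) := by
  rw [fiberKernelSwap, Kernel.map_apply _ measurable_swap, fiberKernel_apply,
    Measure.map_map measurable_swap (measurable_mk_left x)]
  rfl

theorem lintegral_fiberKernel {f : X → Y → ℝ≥0∞}
    (hf : Measurable fun z : BorelProd X Y => f z.fst z.snd) (x : X) :
    ∫⁻ z, f z.fst z.snd ∂(fiberKernel n x) = ∫⁻ y, f x y ∂n := by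
  rw [fiberKernel_apply, lintegral_map hf (measurable_mk_left x)]
  rfl

theorem lintegral_fiberKernelSwap {f : X → Y → ℝ≥0∞}
    (hf : Measurable fun z : BorelProd X Y => f z.fst z.snd) (y : Y) :
    ∫⁻ z, f z.fst z.snd ∂(fiberKernelSwap m y) = ∫⁻ x, f x y ∂m := by
  rw [fiberKernelSwap_apply, lintegral_map hf (measurable_mk_right y)]
  rfl

-- Both orders of integration define one measure on the Borel `σ`-algebra of the product. Tonelli
-- and Fubini then reduce to integration against a composition of a measure with a kernel.
variable (m n) in
theorem bind_fiberKernel_eq :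
    m.bind (fiberKernel n) = n.bind (fiberKernelSwap m) := by
  ext E hE
  rw [Measure.bind_apply hE (Kernel.aemeasurable _), Measure.bind_apply hE (Kernel.aemeasurable _)]
  have h1 : ∀ x, fiberKernel n x E = n (mk x ⁻¹' E) := fun x => by
    rw [fiberKernel_apply, Measure.map_apply (measurable_mk_left x) hE]
  have h2 : ∀ y, fiberKernelSwap m y E = m ((fun x => mk x y) ⁻¹' E) := fun y => by
    rw [fiberKernelSwap_apply, Measure.map_apply (measurable_mk_right y) hE]
  rw [lintegral_congr h1, lintegral_congr h2]
  exact lintegral_measure_section_swap hE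

theorem measurable_lintegral_right {f : X → Y → ℝ≥0∞}
    (hf : Measurable fun z : BorelProd X Y => f z.fst z.snd) :
    Measurable fun x => ∫⁻ y, f x y ∂n := by
  rw [← funext (lintegral_fiberKernel (n := n) hf)]
  exact Measurable.lintegral_kernel hf

theorem lintegral_lintegral_swap {f : X → Y → ℝ≥0∞}
    (hf : Measurable fun z : BorelProd X Y => f z.fst z.snd) :
    ∫⁻ x, ∫⁻ y, f x y ∂n ∂m = ∫⁻ y, ∫⁻ x, f x y ∂m ∂n := by
  have h : ∫⁻ z, f z.fst z.snd ∂(m.bind (fiberKernel n)) =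
      ∫⁻ z, f z.fst z.snd ∂(n.bind (fiberKernelSwap m)) := by rw [bind_fiberKernel_eq]
  rw [Measure.lintegral_bind (Kernel.aemeasurable _) hf.aemeasurable,
    Measure.lintegral_bind (Kernel.aemeasurable _) hf.aemeasurable,
    lintegral_congr (lintegral_fiberKernel hf), lintegral_congr (lintegral_fiberKernelSwap hf)] at h
  exact h

variable {E : Type*} [NormedAddCommGroup E] [NormedSpace ℝ E]

theorem integral_fiberKernel {f : X → Y → E}
    (hf : StronglyMeasurable fun z : BorelProd X Y => f z.fst z.snd) (x : X) :
    ∫ z, f z.fst z.snd ∂(fiberKernel n x) = ∫ y, f x y ∂n := by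
  rw [fiberKernel_apply, integral_map (measurable_mk_left x).aemeasurable hf.aestronglyMeasurable]
  rfl

theorem integral_fiberKernelSwap {f : X → Y → E}
    (hf : StronglyMeasurable fun z : BorelProd X Y => f z.fst z.snd) (y : Y) :
    ∫ z, f z.fst z.snd ∂(fiberKernelSwap m y) = ∫ x, f x y ∂m := by
  rw [fiberKernelSwap_apply,
    integral_map (measurable_mk_right y).aemeasurable hf.aestronglyMeasurable]
  rfl

theorem stronglyMeasurable_integral_right {f : X → Y → E}
    (hf : StronglyMeasurable fun z : BorelProd X Y => f z.fst z.snd) :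
    StronglyMeasurable fun x => ∫ y, f x y ∂n := by
  rw [← funext (integral_fiberKernel (n := n) hf)]
  exact StronglyMeasurable.integral_kernel hf

theorem integral_integral_swap {f : X → Y → E}
    (hf : StronglyMeasurable fun z : BorelProd X Y => f z.fst z.snd)
    (hfin : ∫⁻ x, ∫⁻ y, ‖f x y‖ₑ ∂n ∂m ≠ ∞) :
    ∫ x, ∫ y, f x y ∂n ∂m = ∫ y, ∫ x, f x y ∂m ∂n := by
  have hint : Integrable (fun z : BorelProd X Y => f z.fst z.snd) (m.bind (fiberKernel n)) := by
    refine ⟨hf.aestronglyMeasurable, ?_⟩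
    rw [hasFiniteIntegral_iff_enorm,
      Measure.lintegral_bind (Kernel.aemeasurable _) hf.enorm.aemeasurable,
      lintegral_congr (lintegral_fiberKernel (f := fun x y => ‖f x y‖ₑ) hf.enorm)]
    exact hfin.lt_top
  have hint' := hint
  rw [bind_fiberKernel_eq] at hint'
  have h1 := integral_bind_kernel hint
  have h2 := integral_bind_kernel hint'
  rw [← bind_fiberKernel_eq, h1, integral_congr_ae (ae_of_all _ (integral_fiberKernel hf)),
    integral_congr_ae (ae_of_all _ (integral_fiberKernelSwap hf))] at h2
  exact h2

end BorelProd

end BorelProd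

/-! ### Haar measure on groups that are not second countable -/

section Haar

open Set Measure
open scoped ENNReal NNReal Pointwise

variable {G : Type*} [Group G] [TopologicalSpace G] [IsTopologicalGroup G]

/-- An open subgroup containing a given `σ`-compact set. -/
theorem exists_isOpen_isSigmaCompact_subgroup [LocallyCompactSpace G] {S : Set G}
    (hS : IsSigmaCompact S) :
    ∃ H : Subgroup G, IsOpen (H : Set G) ∧ IsSigmaCompact (H : Set G) ∧ S ⊆ H := by
  obtain ⟨K, hK, rfl⟩ := hS
  obtain ⟨N, hN, hN1⟩ := exists_compact_mem_nhds (1 : G)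
  let L : ℕ → Set G := fun n => N ∪ Set.accumulate K n
  have hL : ∀ n, IsCompact (L n) := fun n => hN.union (isCompact_accumulate hK n)
  let T : ℕ → Set G := fun n => L n ∪ (L n)⁻¹
  have hT : ∀ n, IsCompact (T n) := fun n => (hL n).union (hL n).inv
  have hTinv : ∀ n, (T n)⁻¹ = T n := fun n => by simp [T, union_comm]
  have h1N : (1 : G) ∈ N := mem_of_mem_nhds hN1
  have h1 : ∀ n, (1 : G) ∈ T n := fun n => Or.inl (Or.inl h1N)
  have hLmono : Monotone L := fun i j hij =>
    union_subset_union_right N (monotone_accumulate hij)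
  have hTmono : Monotone T := fun i j hij =>
    union_subset_union (hLmono hij) (inv_subset_inv.2 (hLmono hij))
  have hpow : ∀ {i j}, i ≤ j → T i ^ i ⊆ T j ^ j := fun {i j} hij =>
    (pow_subset_pow_left (hTmono hij)).trans (pow_subset_pow_right (h1 j) hij)
  -- The sets `T i` are compact, symmetric and increasing, and index and exponent grow together: a
  -- product of elements at levels `i` and `j` lies at level `i + j`.
  let H : Subgroup G :=
    { carrier := ⋃ i, T i ^ i
      one_mem' := mem_iUnion.2 ⟨0, by simp⟩
      mul_mem' := by
        intro a b ha hb
        obtain ⟨i, hi⟩ := mem_iUnion.1 ha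
        obtain ⟨j, hj⟩ := mem_iUnion.1 hb
        refine mem_iUnion.2 ⟨i + j, ?_⟩
        rw [pow_add]
        exact Set.mul_mem_mul (pow_subset_pow_left (hTmono (Nat.le_add_right i j)) hi)
          (pow_subset_pow_left (hTmono (Nat.le_add_left j i)) hj)
      inv_mem' := by
        intro a ha
        obtain ⟨i, hi⟩ := mem_iUnion.1 ha
        refine mem_iUnion.2 ⟨i, ?_⟩
        rw [← hTinv i, inv_pow]
        exact Set.inv_mem_inv.2 hi }
  have hsub : ∀ n, L n ⊆ H := fun n => by
    intro x hx
    refine mem_iUnion.2 ⟨n + 1, ?_⟩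
    refine pow_subset_pow_right (h1 (n + 1)) (Nat.le_add_left 1 n) ?_
    rw [pow_one]
    exact hTmono (Nat.le_succ n) (Or.inl hx)
  refine ⟨H, ?_, ⟨fun i => T i ^ i, fun i => ?_, rfl⟩, ?_⟩
  · exact H.isOpen_of_mem_nhds (g := 1)
      (mem_of_superset hN1 (subset_union_left.trans (hsub 0)))
  · have hcomp : ∀ k, IsCompact (T i ^ k) := fun k => by
      induction k with
      | zero => simp
      | succ k ih => rw [pow_succ]; exact ih.mul (hT i)
    exact hcomp i
  · exact iUnion_subset fun n => subset_accumulate.trans (subset_union_right.trans (hsub n))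

variable [LocallyCompactSpace G] [MeasurableSpace G] [BorelSpace G] {μ : Measure G}
  [μ.IsHaarMeasure]

/-- A nonempty intersection of `U` with a coset of an open `σ`-compact subgroup is open, hence of
positive measure. Finite measure allows only countably many of them. -/
theorem IsOpen.exists_isSigmaCompact_superset {U : Set G} (hU : IsOpen U) (hμ : μ U ≠ ∞) :
    ∃ S : Set G, IsSigmaCompact S ∧ U ⊆ S := by
  obtain ⟨H, hH, hHc, -⟩ := exists_isOpen_isSigmaCompact_subgroup (isSigmaCompact_empty (X := G))
  let A : G ⧸ H → Set G := fun q => U ∩ (QuotientGroup.mk ⁻¹' {q})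
  have hcoset : ∀ q : G ⧸ H, (QuotientGroup.mk ⁻¹' {q} : Set G) = q.out • (H : Set G) := by
    intro q
    ext x
    rw [mem_preimage, mem_singleton_iff, mem_leftCoset_iff, SetLike.mem_coe,
      ← QuotientGroup.eq, QuotientGroup.out_eq', eq_comm]
  have hAo : ∀ q, IsOpen (A q) := fun q => by
    simp only [A, hcoset]
    exact hU.inter (hH.smul _)
  have hdisj : Pairwise (Function.onFun Disjoint A) := fun p q hpq =>
    Set.disjoint_left.2 fun x hx hx' => hpq (hx.2.symm.trans hx'.2)
  have hcount := Measure.countable_meas_pos_of_disjoint_of_meas_iUnion_ne_top (μ := μ)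
    (As := A) (fun q => (hAo q).measurableSet) hdisj
    (ne_top_of_le_ne_top hμ (measure_mono (iUnion_subset fun q => inter_subset_left)))
  refine ⟨⋃ q ∈ {q | 0 < μ (A q)}, q.out • (H : Set G),
    isSigmaCompact_biUnion hcount fun q _ => ?_, fun x hx => ?_⟩
  · exact hHc.image (continuous_const_smul q.out)
  · refine mem_iUnion₂.2 ⟨QuotientGroup.mk x, (hAo _).measure_pos μ ⟨x, hx, rfl⟩, ?_⟩
    rw [← hcoset]
    rfl

/-- Outer regularity encloses each set in an open set of finite measure, hence in a `σ`-compact one;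
a single subgroup then absorbs the countable union. -/
theorem exists_subgroup_of_measure_ne_top [μ.Regular] {s : ℕ → Set G} (hs : ∀ n, μ (s n) ≠ ∞) :
    ∃ H : Subgroup G, IsOpen (H : Set G) ∧ IsSigmaCompact (H : Set G) ∧ ∀ n, s n ⊆ H := by
  have h : ∀ n, ∃ S : Set G, IsSigmaCompact S ∧ s n ⊆ S := fun n => by
    obtain ⟨U, hsU, hU, hUμ⟩ := (s n).exists_isOpen_lt_of_lt ∞ (hs n).lt_top (μ := μ)
    obtain ⟨S, hS, hUS⟩ := hU.exists_isSigmaCompact_superset hUμ.ne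
    exact ⟨S, hS, hsU.trans hUS⟩
  choose S hS hsS using h
  obtain ⟨H, hH, hHc, hSH⟩ := exists_isOpen_isSigmaCompact_subgroup (isSigmaCompact_iUnion _ hS)
  exact ⟨H, hH, hHc, fun n => (hsS n).trans ((subset_iUnion S n).trans hSH)⟩

/-- By Markov's inequality the sets `{f ≥ 1 / (n + 1)}` have finite measure, and they exhaust the
points where `f ≠ 0`. This reduces arbitrary `G` to the `σ`-finite case. -/
theorem exists_subgroup_of_lintegral_ne_top [μ.Regular] {f : G → ℝ≥0∞} (hf : Measurable f)
    (hfin : ∫⁻ x, f x ∂μ ≠ ∞) :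
    ∃ H : Subgroup G, IsOpen (H : Set G) ∧ IsSigmaCompact (H : Set G) ∧ ∀ x ∉ H, f x = 0 := by
  obtain ⟨H, hH, hHc, hs⟩ := exists_subgroup_of_measure_ne_top (μ := μ)
    (s := fun n : ℕ => {x | (n + 1 : ℝ≥0∞)⁻¹ ≤ f x}) fun n =>
      ((meas_ge_le_lintegral_div hf.aemeasurable (by simp) (by simp)).trans_lt
        (ENNReal.div_lt_top hfin (by simp))).ne
  refine ⟨H, hH, hHc, fun x hx => ?_⟩
  by_contra h0
  obtain ⟨n, hn⟩ := ENNReal.exists_inv_nat_lt h0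
  refine hx (hs n ?_)
  refine le_trans (ENNReal.inv_le_inv.2 ?_) hn.le
  exact le_self_add

theorem sigmaFinite_restrict_of_isSigmaCompact {S : Set G} (hSm : MeasurableSet S)
    (hS : IsSigmaCompact S) : SigmaFinite (μ.restrict S) := by
  obtain ⟨K, hK, rfl⟩ := hS
  -- Adding the complement, null for the restriction, makes the compact sets span the whole space.
  refine ⟨⟨⟨fun n => K n ∪ (⋃ n, K n)ᶜ, fun _ => trivial, fun n => ?_, ?_⟩⟩⟩
  · refine (measure_union_le _ _).trans_lt ?_
    rw [Measure.restrict_apply hSm.compl, Set.compl_inter_self, measure_empty, add_zero]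
    exact (Measure.restrict_apply_le _ _).trans_lt (hK n).measure_lt_top
  · rw [← iUnion_union, union_compl_self]

/-! ### The modular character and inversion of Haar measure -/

variable [μ.Regular]

variable (μ) in
theorem map_mul_right_eq_modularCharacterFun_smul (g : G) :
    μ.map (· * g) = modularCharacterFun g • μ := by
  rw [modularCharacterFun_eq_haarScalarFactor μ g]
  have : (μ.map (· * g)).Regular := Regular.map (Homeomorph.mulRight g)
  exact isMulLeftInvariant_eq_smul_of_regular _ μ

theorem lintegral_mul_right_eq_modularCharacterFun_mul {f : G → ℝ≥0∞} (hf : Measurable f) (g : G) :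
    ∫⁻ x, f (x * g) ∂μ = modularCharacterFun g * ∫⁻ x, f x ∂μ := by
  rw [← lintegral_map hf (measurable_mul_const g), map_mul_right_eq_modularCharacterFun_smul,
    lintegral_smul_measure]
  rfl

/-- The character at `g` is the ratio of `∫ f (y * g)` to `∫ f` for a bump function `f`, and the
numerator depends continuously on `g`. The inverted measure only brings the integrand into the form
`f (y⁻¹ * g)`. -/
theorem continuous_modularCharacterFun :
    Continuous (modularCharacterFun : G → ℝ≥0) := by
  borelize G
  let μ : Measure G := haar
  obtain ⟨⟨f, hf⟩, hfc, hf0, hf1⟩ :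
    ∃ f : C(G, ℝ), HasCompactSupport f ∧ 0 ≤ f ∧ f 1 ≠ 0 := exists_continuous_nonneg_pos 1
  have hpos : 0 < ∫ x, f x ∂μ :=
    hf.integral_pos_of_hasCompactSupport_nonneg_nonzero hfc hf0 hf1
  have h : ∀ g, (modularCharacterFun g : ℝ) = (∫ y, f (y⁻¹ * g) ∂μ.inv) / ∫ x, f x ∂μ := by
    intro g
    have h1 : ∫ y, f (y⁻¹ * g) ∂μ.inv = ∫ y, f (y * g) ∂μ := by
      rw [Measure.inv, integral_map measurable_inv.aemeasurable
        (by fun_prop : Continuous fun y => f (y⁻¹ * g)).aestronglyMeasurable]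
      simp
    have h2 : ∫ y, f (y * g) ∂μ = ∫ y, f y ∂(μ.map (· * g)) := by
      rw [integral_map (measurable_mul_const g).aemeasurable hf.aestronglyMeasurable]
    rw [h1, h2, map_mul_right_eq_modularCharacterFun_smul, integral_smul_nnreal_measure,
      NNReal.smul_def, smul_eq_mul, mul_div_cancel_right₀ _ hpos.ne']
  rw [NNReal.isEmbedding_coe.continuous_iff]
  have : (fun g : G => (modularCharacterFun g : ℝ)) = fun g =>
    (∫ y, f (y⁻¹ * g) ∂μ.inv) / ∫ x, f x ∂μ := funext h
  change Continuous fun g : G => (modularCharacterFun g : ℝ)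
  rw [this]
  exact (continuous_integral_apply_inv_mul hf hfc).div_const _

theorem measurable_modularCharacterFun :
    Measurable (fun g : G => (modularCharacterFun g : ℝ≥0∞)) :=
  (ENNReal.continuous_coe.comp continuous_modularCharacterFun).measurable

variable (μ) in
/-- The image under inversion of the Haar measure with density the modular character. -/
noncomputable def modularInv : Measure G :=
  (μ.withDensity fun x => (modularCharacterFun x : ℝ≥0∞)).map Inv.inv

theorem lintegral_modularInv {f : G → ℝ≥0∞} (hf : Measurable f) :
    ∫⁻ x, f x ∂(modularInv μ) = ∫⁻ x, modularCharacterFun x * f x⁻¹ ∂μ := by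
  rw [modularInv, lintegral_map hf measurable_inv,
    lintegral_withDensity_eq_lintegral_mul _ measurable_modularCharacterFun
      (show Measurable fun x => f x⁻¹ from hf.comp measurable_inv)]
  rfl

/-- Inversion turns left translation by `g` into right translation by `g⁻¹`, whose modular factor
cancels the one coming from the density. -/
instance : (modularInv μ).IsMulLeftInvariant := by
  refine ⟨fun g => ?_⟩
  ext E hE
  have hind : Measurable (E.indicator (1 : G → ℝ≥0∞)) := measurable_one.indicator hE
  have key : ∀ ρ : Measure G, ρ E = ∫⁻ x, E.indicator (1 : G → ℝ≥0∞) x ∂ρ := fun ρ => by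
    rw [lintegral_indicator_one hE]
  rw [key, key, lintegral_map hind (measurable_const_mul g), lintegral_modularInv hind,
    lintegral_modularInv (show Measurable fun x => E.indicator (1 : G → ℝ≥0∞) (g * x) from
      hind.comp (measurable_const_mul g))]
  have h := lintegral_mul_right_eq_modularCharacterFun_mul (μ := μ)
    (f := fun x => modularCharacterFun (x * g) * E.indicator (1 : G → ℝ≥0∞) x⁻¹)
    ((measurable_modularCharacterFun.comp (measurable_mul_const g)).mul
      (hind.comp measurable_inv)) g⁻¹
  simp only [inv_mul_cancel_right, mul_inv_rev, inv_inv] at h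
  rw [h]
  simp only [modularCharacterFun_map_mul, ENNReal.coe_mul]
  have hm : Measurable fun x : G => (modularCharacterFun x : ℝ≥0∞) *
      E.indicator (1 : G → ℝ≥0∞) x⁻¹ :=
    measurable_modularCharacterFun.mul (hind.comp measurable_inv)
  have h2 : ∀ x : G, (modularCharacterFun x : ℝ≥0∞) * modularCharacterFun g *
      E.indicator (1 : G → ℝ≥0∞) x⁻¹ =
      modularCharacterFun g * (modularCharacterFun x * E.indicator (1 : G → ℝ≥0∞) x⁻¹) :=
    fun x => by ring
  simp_rw [h2]
  rw [lintegral_const_mul _ hm, ← mul_assoc, ← ENNReal.coe_mul, ← modularCharacterFun_map_mul,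
    inv_mul_cancel, modularCharacterFun_map_one, ENNReal.coe_one, one_mul]

instance [T2Space G] : IsFiniteMeasureOnCompacts (modularInv μ) := by
  refine ⟨fun K hK => ?_⟩
  obtain ⟨C, hC⟩ := (hK.inv.image (continuous_modularCharacterFun (G := G))).bddAbove
  rw [modularInv, Measure.map_apply measurable_inv hK.measurableSet,
    withDensity_apply _ (hK.measurableSet.preimage measurable_inv)]
  calc ∫⁻ x in Inv.inv ⁻¹' K, (modularCharacterFun x : ℝ≥0∞) ∂μ
      ≤ ∫⁻ _ in Inv.inv ⁻¹' K, (C : ℝ≥0∞) ∂μ :=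
        setLIntegral_mono measurable_const fun x hx =>
          ENNReal.coe_le_coe.2 (hC ⟨x, hx, rfl⟩)
    _ = C * μ (K⁻¹) := by rw [setLIntegral_const]; rfl
    _ < ∞ := ENNReal.mul_lt_top ENNReal.coe_lt_top hK.inv.measure_lt_top

/-- Uniqueness of Haar measure on sets with compact closure needs no regularity of `modularInv μ`;
increasing unions extend it to subsets of `σ`-compact sets. -/
theorem modularInv_apply_of_subset [T2Space G] {E S : Set G}
    (hS : IsSigmaCompact S) (hES : E ⊆ S) :
    modularInv μ E = haarScalarFactor (modularInv μ) μ • μ E := by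
  obtain ⟨K, hK, rfl⟩ := hS
  have hm : Monotone fun n => E ∩ Set.accumulate K n := fun i j hij =>
    inter_subset_inter_right E (monotone_accumulate hij)
  have hU : E = ⋃ n, E ∩ Set.accumulate K n := by
    rw [← inter_iUnion, iUnion_accumulate, inter_eq_left.2 hES]
  rw [hU, hm.measure_iUnion, hm.measure_iUnion, ENNReal.smul_def, smul_eq_mul, ENNReal.mul_iSup]
  refine iSup_congr fun n => ?_
  exact measure_isMulInvariant_eq_smul_of_isCompact_closure _ _
    ((isCompact_accumulate hK n).closure_of_subset inter_subset_right)

theorem lintegral_modularInv_eq_smul [T2Space G] {f : G → ℝ≥0∞} {S : Set G}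
    (hSm : MeasurableSet S) (hS : IsSigmaCompact S) (hfS : ∀ x ∉ S, f x = 0) :
    ∫⁻ x, f x ∂(modularInv μ) = haarScalarFactor (modularInv μ) μ * ∫⁻ x, f x ∂μ := by
  have h : ∀ ρ : Measure G, ∫⁻ x, f x ∂ρ = ∫⁻ x in S, f x ∂ρ := fun ρ => by
    rw [← lintegral_indicator hSm]
    congr 1
    ext x
    by_cases hx : x ∈ S
    · simp [hx]
    · simp [hx, hfS x hx]
  have h2 : (modularInv μ).restrict S = haarScalarFactor (modularInv μ) μ • μ.restrict S := by
    ext E hE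
    rw [Measure.restrict_apply hE, modularInv_apply_of_subset hS inter_subset_right,
      Measure.smul_apply, Measure.restrict_apply hE]
  rw [h, h μ, h2, lintegral_smul_measure]
  rfl

-- The transformation `f ↦ Δ(x⁻¹) f(x⁻¹)` is an involution, and it multiplies integrals by the
-- factor `c`. Hence `c ^ 2 = 1`, tested on a compact neighbourhood of the identity, and `c ≥ 0`.
variable (μ) in
theorem haarScalarFactor_modularInv [T2Space G] : haarScalarFactor (modularInv μ) μ = 1 := by
  obtain ⟨K, hK, hK1⟩ := exists_compact_mem_nhds (1 : G)
  obtain ⟨H, hH, hHc, hKH⟩ := exists_isOpen_isSigmaCompact_subgroup hK.isSigmaCompact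
  set c := haarScalarFactor (modularInv μ) μ
  let f : G → ℝ≥0∞ := K.indicator 1
  have hf : Measurable f := measurable_one.indicator hK.measurableSet
  have hfH : ∀ x ∉ (H : Set G), f x = 0 := fun x hx =>
    indicator_of_notMem (fun h => hx (hKH h)) _
  let f' : G → ℝ≥0∞ := fun x => modularCharacterFun x * f x⁻¹
  have hf' : Measurable f' := measurable_modularCharacterFun.mul (hf.comp measurable_inv)
  have hf'H : ∀ x ∉ (H : Set G), f' x = 0 := fun x hx => by
    simp only [f']
    rw [hfH x⁻¹ (fun h => hx (by simpa using h)), mul_zero]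
  have e1 := lintegral_modularInv_eq_smul (μ := μ) hH.measurableSet hHc hfH
  have e2 := lintegral_modularInv_eq_smul (μ := μ) hH.measurableSet hHc hf'H
  rw [lintegral_modularInv hf] at e1
  rw [lintegral_modularInv hf', e1] at e2
  have e3 : ∀ x : G, modularCharacterFun x * f' x⁻¹ = f x := fun x => by
    simp only [f', inv_inv]
    rw [← mul_assoc, ← ENNReal.coe_mul, ← modularCharacterFun_map_mul, mul_inv_cancel,
      modularCharacterFun_map_one, ENNReal.coe_one, one_mul]
  simp_rw [e3] at e2
  have hI : ∫⁻ x, f x ∂μ = μ K := lintegral_indicator_one hK.measurableSet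
  have h0 : (μ K).toReal ≠ 0 :=
    (ENNReal.toReal_pos (measure_pos_of_mem_nhds μ hK1).ne' hK.measure_lt_top.ne).ne'
  rw [hI] at e2
  have e4 := congrArg ENNReal.toReal e2
  rw [ENNReal.toReal_mul, ENNReal.toReal_mul, ENNReal.coe_toReal, ← mul_assoc] at e4
  have e5 : (c : ℝ) * c = 1 := by
    have : ((c : ℝ) * c - 1) * (μ K).toReal = 0 := by linarith
    rcases mul_eq_zero.1 this with h | h
    · linarith
    · exact absurd h h0
  have e6 : (c : ℝ) = 1 := by nlinarith [c.coe_nonneg]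
  exact_mod_cast e6

theorem lintegral_modularCharacterFun_mul_inv [T2Space G] {f : G → ℝ≥0∞} (hf : Measurable f)
    {S : Set G} (hSm : MeasurableSet S) (hS : IsSigmaCompact S) (hfS : ∀ x ∉ S, f x = 0) :
    ∫⁻ x, modularCharacterFun x * f x⁻¹ ∂μ = ∫⁻ x, f x ∂μ := by
  rw [← lintegral_modularInv hf, lintegral_modularInv_eq_smul hSm hS hfS,
    haarScalarFactor_modularInv, ENNReal.coe_one, one_mul]

-- A null set lies in a `σ`-compact subgroup, where the change of variables applies; positivity of
-- the modular character gives that its inverse is null. This makes `Φ(x⁻¹)` and `Ψ(y⁻¹x)`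
-- independent of the representatives up to null sets.
variable (μ) in
theorem quasiMeasurePreserving_inv_haar [T2Space G] :
    QuasiMeasurePreserving (Inv.inv : G → G) μ μ := by
  refine ⟨measurable_inv, AbsolutelyContinuous.mk fun E hE h0 => ?_⟩
  obtain ⟨H, hH, hHc, hs⟩ := exists_subgroup_of_measure_ne_top (μ := μ) (s := fun _ => E)
    (fun _ => h0 ▸ ENNReal.zero_ne_top)
  have hf : Measurable (E.indicator (1 : G → ℝ≥0∞)) := measurable_one.indicator hE
  have h := lintegral_modularCharacterFun_mul_inv (μ := μ) hf hH.measurableSet hHc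
    (fun x hx => indicator_of_notMem (fun h => hx (hs 0 h)) _)
  have hm : Measurable fun x : G => (modularCharacterFun x : ℝ≥0∞) *
      E.indicator (1 : G → ℝ≥0∞) x⁻¹ :=
    measurable_modularCharacterFun.mul (hf.comp measurable_inv)
  rw [lintegral_indicator_one hE, h0, lintegral_eq_zero_iff hm] at h
  rw [Measure.map_apply measurable_inv hE]
  refine measure_mono_null (fun x hx => ?_) (ae_iff.1 h)
  have hpos := (modularCharacterFun_pos x).ne'
  have hx' : x⁻¹ ∈ E := hx
  simp [hx', hpos]

variable (μ) in
theorem quasiMeasurePreserving_inv_mul_haar [T2Space G] (x : G) :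
    QuasiMeasurePreserving (fun y : G => y⁻¹ * x) μ μ := by
  have h := (quasiMeasurePreserving_inv_haar μ).comp
    (measurePreserving_mul_left μ x⁻¹).quasiMeasurePreserving
  have e : (fun y : G => y⁻¹ * x) = Inv.inv ∘ fun y => x⁻¹ * y := by
    ext y; simp
  rw [e]
  exact h

end Haar

/-! ### The algebra of a twisted action -/

section Multiplier

variable {B : Type*} [NonUnitalNormedRing B] [StarRing B] [NormedStarGroup B] [NormedSpace ℂ B]
  [IsScalarTower ℂ B B] [SMulCommClass ℂ B B] [StarModule ℂ B]

namespace IsUnitaryMultiplier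

variable {u v w : 𝓜(ℂ, B)}

theorem norm_snd_le (hu : IsUnitaryMultiplier u) (b : B) : ‖u.snd b‖ ≤ ‖b‖ := by
  have h : ‖u.snd‖ ≤ 1 := (le_max_right ‖u.fst‖ ‖u.snd‖).trans hu.norm_le_one
  exact (u.snd.le_opNorm b).trans (mul_le_of_le_one_left (norm_nonneg _) h)

theorem star_fst_fst (hu : IsUnitaryMultiplier u) (b : B) : (star u).fst (u.fst b) = b := by
  have h := congrArg (fun m : 𝓜(ℂ, B) => m.fst b) hu.star_mul_self
  simpa using h

theorem snd_star_snd (hu : IsUnitaryMultiplier u) (b : B) : u.snd ((star u).snd b) = b := by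
  have h := congrArg (fun m : 𝓜(ℂ, B) => m.snd b) hu.star_mul_self
  simpa using h

theorem snd_star_fst (hu : IsUnitaryMultiplier u) (b : B) : u.snd (star (u.fst b)) = star b := by
  have h := hu.snd_star_snd (star b)
  rwa [DoubleCentralizer.star_snd, star_star] at h

theorem star_fst_mul (hu : IsUnitaryMultiplier u) (a b : B) :
    (star u).fst (a * b) = (star u).fst a * b := by
  simp [DoubleCentralizer.star_fst, hu.snd_mul]

/-- In multiplier notation both sides are `w^* c^* u^* b^*`: on the left the factor `v^* v = 1`
cancels. The double centralizer relation `central` moves multipliers between neighbouring elements.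
-/
theorem star_snd_mul_star_snd (hv : IsUnitaryMultiplier v)
    (hw : IsUnitaryMultiplier w) (b c : B) :
    star (w.snd c) * v.snd (star (u.snd (v.fst b))) = star (w.snd (u.fst c)) * star b := by
  apply star_injective
  rw [star_mul, star_mul, star_star, star_star, star_star]
  have h1 : star (v.snd (star (u.snd (v.fst b)))) = (star v).fst (u.snd (v.fst b)) :=
    (DoubleCentralizer.star_fst v _).symm
  rw [h1, ← hv.star_fst_mul, u.central, ← hv.fst_mul, hv.star_fst_fst, ← u.central,
    ← hw.snd_mul, u.central, hw.snd_mul]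

end IsUnitaryMultiplier

end Multiplier

namespace TwistedAction

section Algebra

variable {G B : Type*} [Group G] [TopologicalSpace G]
  [NonUnitalNormedRing B] [StarRing B] [NormedStarGroup B] [NormedSpace ℂ B]
  [IsScalarTower ℂ B B] [SMulCommClass ℂ B B] [StarModule ℂ B] (T : TwistedAction G B)

/-- The product `a α_p(b) ω(p, q)` of an element `a` over `p` and an element `b` over `q`. -/
noncomputable def fiberMul (p q : G) (a b : B) : B := (T.ω p q).snd (a * T.α p b)

/-- The adjoint `ω(p, p⁻¹)^* α_p(a^*)`, over `p`, of an element `a` over `p⁻¹`. -/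
noncomputable def fiberStar (p : G) (a : B) : B := star ((T.ω p p⁻¹).snd (T.α p a))

theorem cocycle_snd (x y z : G) (c : B) :
    (T.ω x (y * z)).snd (T.α x ((T.ω y z).snd c)) =
      (T.ω (x * y) z).snd ((T.ω x y).snd (T.α x c)) := by
  have h := congrArg (fun m : 𝓜(ℂ, B) => m.snd (T.α x c)) (T.cocycle x y z)
  simpa [multiplierMap, isometricAutCLM] using h

/-- The cocycle identity at `(x, x⁻¹, x)`, where the two outer multipliers are trivial. -/
theorem α_snd_inv (x : G) (c : B) :
    T.α x ((T.ω x⁻¹ x).snd c) = (T.ω x x⁻¹).snd (T.α x c) := by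
  have h := T.cocycle_snd x x⁻¹ x c
  simpa [T.ω_one_right, T.ω_one_left] using h

/-- The cocycle identity regroups the multipliers, and the twist relation exchanges `α_p(α_q(c))`
for `α_{pq}(c)` across `ω(p, q)`. -/
theorem fiberMul_assoc (p q r : G) (a b c : B) :
    T.fiberMul (p * q) r (T.fiberMul p q a b) c = T.fiberMul p (q * r) a (T.fiberMul q r b c) := by
  simp only [fiberMul]
  rw [(T.unitary_ω p (q * r)).snd_mul, T.cocycle_snd, map_mul (T.α p),
    (T.unitary_ω p q).snd_mul (T.α p b), T.twist, ← (T.ω p q).central,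
    ← (T.unitary_ω (p * q) r).snd_mul a, ← mul_assoc, ← (T.unitary_ω p q).snd_mul]

theorem fiberStar_fiberStar (p : G) (a : B) : T.fiberStar p (T.fiberStar p⁻¹ a) = a := by
  simp only [fiberStar, inv_inv]
  rw [map_star, T.α_snd_inv, T.twist, mul_inv_cancel, T.α_one, (T.unitary_ω _ _).snd_star_fst,
    star_star]

/-- Two cocycle identities, at `(x, y, y⁻¹x⁻¹)` and at `(xy, y⁻¹, y)`, bring both sides to the form
of `star_snd_mul_star_snd` with `u = ω(x, y)`. -/
theorem fiberStar_fiberMul (x y : G) (a b : B) :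
    T.fiberStar x (T.fiberMul y (y⁻¹ * x⁻¹) b a) =
      T.fiberMul (x * y) y⁻¹ (T.fiberStar (x * y) a) (T.fiberStar y⁻¹ b) := by
  have hxy : x * y * y⁻¹ = x := by group
  have h1 := T.cocycle_snd x y (y⁻¹ * x⁻¹) (b * T.α y a)
  have h2 := T.cocycle_snd (x * y) y⁻¹ y (T.α y⁻¹ b)
  rw [mul_inv_cancel_left] at h1
  rw [inv_mul_cancel, T.ω_one_right, T.twist, hxy] at h2
  rw [DoubleCentralizer.one_snd] at h2
  change T.α (x * y) _ = _ at h2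
  simp only [fiberMul, fiberStar, inv_inv]
  rw [h1, map_mul (T.α x), (T.unitary_ω x y).snd_mul, (T.unitary_ω (x * y) _).snd_mul, T.twist,
    star_mul, (T.unitary_ω (x * y) y⁻¹).snd_mul, map_star, h2, mul_inv_rev,
    (T.unitary_ω (x * y) y⁻¹).star_snd_mul_star_snd (T.unitary_ω (x * y) _)]

theorem norm_fiberMul_le (p q : G) (a b : B) : ‖T.fiberMul p q a b‖ ≤ ‖a‖ * ‖b‖ :=
  ((T.unitary_ω p q).norm_snd_le _).trans ((norm_mul_le _ _).trans_eq (by rw [T.norm_α]))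

theorem norm_fiberStar_le (p : G) (a : B) : ‖T.fiberStar p a‖ ≤ ‖a‖ := by
  rw [fiberStar, norm_star]
  exact ((T.unitary_ω _ _).norm_snd_le _).trans_eq (T.norm_α _ _)

/-- The map `a ↦ a α_p(b) ω(p, q)`. -/
noncomputable def fiberMulLeft (p q : G) (b : B) : B →L[ℂ] B :=
  LinearMap.mkContinuous
    { toFun := fun a => T.fiberMul p q a b
      map_add' := fun a a' => by simp [fiberMul, add_mul]
      map_smul' := fun z a => by simp [fiberMul, smul_mul_assoc] } ‖b‖
    (fun a => (T.norm_fiberMul_le p q a b).trans_eq (mul_comm _ _))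

/-- The map `b ↦ a α_p(b) ω(p, q)`. -/
noncomputable def fiberMulRight (p q : G) (a : B) : B →L[ℂ] B :=
  LinearMap.mkContinuous
    { toFun := fun b => T.fiberMul p q a b
      map_add' := fun b b' => by simp [fiberMul, mul_add]
      map_smul' := fun z b => by simp [fiberMul, mul_smul_comm] } ‖a‖
    (fun b => T.norm_fiberMul_le p q a b)

theorem fiberMul_add_left (p q : G) (a a' b : B) :
    T.fiberMul p q (a + a') b = T.fiberMul p q a b + T.fiberMul p q a' b :=
  map_add (T.fiberMulLeft p q b) a a'

theorem fiberMul_add_right (p q : G) (a b b' : B) :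
    T.fiberMul p q a (b + b') = T.fiberMul p q a b + T.fiberMul p q a b' :=
  map_add (T.fiberMulRight p q a) b b'

theorem fiberMul_smul_left (p q : G) (z : ℂ) (a b : B) :
    T.fiberMul p q (z • a) b = z • T.fiberMul p q a b :=
  map_smul (T.fiberMulLeft p q b) z a

theorem fiberMul_smul_right (p q : G) (z : ℂ) (a b : B) :
    T.fiberMul p q a (z • b) = z • T.fiberMul p q a b :=
  map_smul (T.fiberMulRight p q a) z b

theorem fiberMul_zero_left (p q : G) (b : B) : T.fiberMul p q 0 b = 0 :=
  map_zero (T.fiberMulLeft p q b)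

theorem fiberMul_zero_right (p q : G) (a : B) : T.fiberMul p q a 0 = 0 :=
  map_zero (T.fiberMulRight p q a)

theorem fiberStar_add (p : G) (a b : B) :
    T.fiberStar p (a + b) = T.fiberStar p a + T.fiberStar p b := by
  simp [fiberStar]

theorem fiberStar_smul (p : G) (z : ℂ) (a : B) :
    T.fiberStar p (z • a) = (starRingEnd ℂ z) • T.fiberStar p a := by
  simp [fiberStar, star_smul]

theorem fiberStar_zero (p : G) : T.fiberStar p 0 = 0 := by
  simp [fiberStar]

/-- The adjoint as a real-linear map. -/
noncomputable def fiberStarL (p : G) : B →L[ℝ] B :=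
  LinearMap.mkContinuous
    { toFun := T.fiberStar p
      map_add' := T.fiberStar_add p
      map_smul' := fun r a => by
        have h := T.fiberStar_smul p (r : ℂ) a
        rw [Complex.conj_ofReal, Complex.coe_smul, Complex.coe_smul] at h
        exact h } 1
    (fun a => by simpa using T.norm_fiberStar_le p a)

theorem fiberStarL_apply (p : G) (a : B) : T.fiberStarL p a = T.fiberStar p a := rfl

end Algebra

/-! ### Compatibility of the fibre operations with the inclusion -/

section Restrict

variable {G A B : Type*} [Group G] [TopologicalSpace G]
  [NonUnitalNormedRing A] [StarRing A] [NormedStarGroup A] [NormedSpace ℂ A]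
  [IsScalarTower ℂ A A] [SMulCommClass ℂ A A] [StarModule ℂ A]
  [NonUnitalNormedRing B] [StarRing B] [NormedStarGroup B] [NormedSpace ℂ B]
  [IsScalarTower ℂ B B] [SMulCommClass ℂ B B] [StarModule ℂ B]
  {T : TwistedAction G B} {ι : A →L[ℂ] B} {S : TwistedAction G A}

theorem RestrictsTo.map_fiberMul (h : T.RestrictsTo ι S) (hmul : ∀ a b, ι (a * b) = ι a * ι b)
    (p q : G) (a b : A) : ι (S.fiberMul p q a b) = T.fiberMul p q (ι a) (ι b) := by
  simp only [fiberMul]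
  rw [h.map_ω_snd, hmul, h.map_α]

theorem RestrictsTo.map_fiberStar (h : T.RestrictsTo ι S) (hstar : ∀ a, ι (star a) = star (ι a))
    (p : G) (a : A) : ι (S.fiberStar p a) = T.fiberStar p (ι a) := by
  simp only [fiberStar]
  rw [hstar, h.map_ω_snd, h.map_α]

end Restrict

end TwistedAction

/-! ### Measurability -/

section Measurability

/-- A jointly measurable application of a family of continuous maps that depends measurably on a
parameter. -/
theorem MeasureTheory.StronglyMeasurable.indicator_apply_of_forall {Z E F : Type*}
    [MeasurableSpace Z] [NormedAddCommGroup E] [NormedAddCommGroup F] {L : Z → E → F}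
    {R : Set Z} (hLc : ∀ z, Continuous (L z))
    (hL : ∀ b, StronglyMeasurable (R.indicator fun z => L z b)) {f : Z → E}
    (hf : StronglyMeasurable f) : StronglyMeasurable (R.indicator fun z => L z (f z)) := by
  refine stronglyMeasurable_of_tendsto (u := atTop)
    (f := fun n => R.indicator fun z => L z (hf.approx n z)) (fun n => ?_) ?_
  -- Where the simple approximation takes the value `c`, only the map `z ↦ L z c` with `c` fixed is
  -- involved.
  · have : (R.indicator fun z => L z (hf.approx n z)) = fun z =>
        ∑ c ∈ (hf.approx n).range, ((hf.approx n) ⁻¹' {c}).indicator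
          (R.indicator fun z => L z c) z := by
      ext z
      rw [Finset.sum_eq_single (hf.approx n z)]
      · rw [Set.indicator_of_mem (show z ∈ (hf.approx n) ⁻¹' {hf.approx n z} from rfl)]
        by_cases hz : z ∈ R <;> simp [hz]
      · intro c _ hc
        refine Set.indicator_of_notMem ?_ _
        exact fun h => hc (Eq.symm h)
      · intro h
        exact absurd ((hf.approx n).mem_range_self z) h
    rw [this]
    exact Finset.stronglyMeasurable_fun_sum _ fun c _ =>
      (hL c).indicator ((hf.approx n).measurableSet_fiber c)
  · refine tendsto_pi_nhds.2 fun z => ?_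
    by_cases hz : z ∈ R
    · simp only [hz, Set.indicator_of_mem]
      exact ((hLc z).tendsto _).comp (hf.tendsto_approx z)
    · simp [hz]

/-- Separability of the values is known on compact sets only, hence on `σ`-compact ones; this forces
the restriction to `R`. -/
theorem IsStronglyBorel.stronglyMeasurable_indicator {X E : Type*} [TopologicalSpace X]
    [MeasurableSpace X] [BorelSpace X] [NormedAddCommGroup E] {f : X → E}
    (hf : IsStronglyBorel f) {R : Set X} (hR : MeasurableSet R) (hRc : IsSigmaCompact R) :
    StronglyMeasurable (R.indicator f) := by
  borelize E
  have hm : Measurable f := by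
    have h := hf.1
    rwa [← BorelSpace.measurable_eq (α := X)] at h
  refine stronglyMeasurable_iff_measurable_separable.2 ⟨hm.indicator hR, ?_⟩
  obtain ⟨K, hK, rfl⟩ := hRc
  have h1 : TopologicalSpace.IsSeparable (f '' (⋃ n, K n) ∪ {0}) := by
    refine TopologicalSpace.IsSeparable.union ?_ (Set.finite_singleton 0).isSeparable
    rw [Set.image_iUnion]
    exact TopologicalSpace.IsSeparable.iUnion fun n => hf.2 _ (hK n)
  refine h1.mono ?_
  rintro _ ⟨x, rfl⟩
  by_cases hx : x ∈ ⋃ n, K n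
  · rw [Set.indicator_of_mem hx]
    exact Or.inl ⟨x, hx, rfl⟩
  · rw [Set.indicator_of_notMem hx]
    exact Or.inr rfl

theorem IsSigmaCompact.prod_borelProd {X Y : Type*} [TopologicalSpace X] [TopologicalSpace Y]
    {S : Set X} {R : Set Y} (hS : IsSigmaCompact S) (hR : IsSigmaCompact R) :
    IsSigmaCompact ({z | z.fst ∈ S ∧ z.snd ∈ R} : Set (BorelProd X Y)) := by
  obtain ⟨K, hK, rfl⟩ := hS
  obtain ⟨L, hL, rfl⟩ := hR
  have h : ({z | z.fst ∈ ⋃ n, K n ∧ z.snd ∈ ⋃ n, L n} : Set (BorelProd X Y)) =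
      ⋃ (i : ℕ × ℕ), (K i.1 ×ˢ L i.2 : Set (X × Y)) := by
    ext z
    constructor
    · rintro ⟨h1, h2⟩
      obtain ⟨i, hi⟩ := Set.mem_iUnion.1 h1
      obtain ⟨j, hj⟩ := Set.mem_iUnion.1 h2
      exact Set.mem_iUnion.2 ⟨(i, j), hi, hj⟩
    · intro hz
      obtain ⟨i, h1, h2⟩ := Set.mem_iUnion.1 hz
      exact ⟨Set.mem_iUnion.2 ⟨_, h1⟩, Set.mem_iUnion.2 ⟨_, h2⟩⟩
  rw [h]
  exact isSigmaCompact_iUnion_of_isCompact _ fun i => (hK i.1).prod (hL i.2)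

namespace TwistedAction

variable {G B : Type*} [Group G] [TopologicalSpace G]
  [NonUnitalNormedRing B] [StarRing B] [NormedStarGroup B] [NormedSpace ℂ B]
  [IsScalarTower ℂ B B] [SMulCommClass ℂ B B] [StarModule ℂ B] (T : TwistedAction G B)
  {H : Set G} {Z : Type*} [MeasurableSpace Z]

theorem stronglyMeasurable_α_indicator [MeasurableSpace G] [BorelSpace G]
    (hH : IsOpen H) (hHc : IsSigmaCompact H) {p : Z → G} (hp : Measurable p) {f : Z → B}
    (hf : StronglyMeasurable f) :
    StronglyMeasurable ((p ⁻¹' H).indicator fun z => T.α (p z) (f z)) := by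
  refine StronglyMeasurable.indicator_apply_of_forall (L := fun z b => T.α (p z) b)
    (fun z => (isometricAutCLM (T.α (p z)) (T.norm_α _)).continuous)
    (fun b => ?_) hf
  exact ((T.borel_α b).stronglyMeasurable_indicator hH.measurableSet hHc).comp_measurable hp

theorem stronglyMeasurable_ω_snd (hH : IsOpen H) (hHc : IsSigmaCompact H)
    {p q : Z → G}
    (hpq : Measurable fun z => BorelProd.mk (p z) (q z)) {f : Z → B}
    (hf : StronglyMeasurable f) (hf0 : ∀ z, ¬ (p z ∈ H ∧ q z ∈ H) → f z = 0) :
    StronglyMeasurable fun z => (T.ω (p z) (q z)).snd (f z) := by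
  set R : Set (BorelProd G G) := {z | z.fst ∈ H ∧ z.snd ∈ H}
  have hR : IsOpen R := (hH.preimage BorelProd.continuous_fst).inter
    (hH.preimage BorelProd.continuous_snd)
  have hRc : IsSigmaCompact R := hHc.prod_borelProd hHc
  have hb : ∀ b, IsStronglyBorel fun z : BorelProd G G => (T.ω z.fst z.snd).snd b := T.borel_ω_snd
  have h := StronglyMeasurable.indicator_apply_of_forall
    (L := fun z b => (T.ω (p z) (q z)).snd b) (R := (fun z => BorelProd.mk (p z) (q z)) ⁻¹' R)
    (fun z => ((T.ω (p z) (q z)).snd).continuous)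
    (fun b => ((hb b).stronglyMeasurable_indicator hR.measurableSet hRc).comp_measurable hpq) hf
  convert h using 1
  ext z
  by_cases hz : p z ∈ H ∧ q z ∈ H
  · rw [Set.indicator_of_mem]
    exact hz
  · rw [Set.indicator_of_notMem, hf0 z hz, map_zero]
    exact hz

theorem stronglyMeasurable_fiberMul [MeasurableSpace G] [BorelSpace G]
    (hH : IsOpen H) (hHc : IsSigmaCompact H) {p q : Z → G}
    (hpq : Measurable fun z => BorelProd.mk (p z) (q z)) {f g : Z → B}
    (hf : StronglyMeasurable f) (hg : StronglyMeasurable g)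
    (hf0 : ∀ z, p z ∉ H → f z = 0) (hg0 : ∀ z, q z ∉ H → g z = 0) :
    StronglyMeasurable fun z => T.fiberMul (p z) (q z) (f z) (g z) := by
  have hp : Measurable p := BorelProd.continuous_fst.measurable.comp hpq
  refine T.stronglyMeasurable_ω_snd hH hHc hpq ?_ fun z hz => ?_
  · have h := hf.mul (T.stronglyMeasurable_α_indicator hH hHc hp hg)
    convert h using 1
    ext z
    by_cases hz : p z ∈ H
    · rw [Pi.mul_apply, Set.indicator_of_mem]
      exact hz
    · simp [hf0 z hz]
  · by_cases hp' : p z ∈ H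
    · rw [hg0 z fun h => hz ⟨hp', h⟩, map_zero, mul_zero]
    · rw [hf0 z hp', zero_mul]

theorem stronglyMeasurable_fiberStar [MeasurableSpace G] [BorelSpace G]
    (hH : IsOpen H) (hHc : IsSigmaCompact H) {p : Z → G}
    (hpq : Measurable fun z => BorelProd.mk (p z) (p z)⁻¹) {f : Z → B}
    (hf : StronglyMeasurable f) (hf0 : ∀ z, ¬ (p z ∈ H ∧ (p z)⁻¹ ∈ H) → f z = 0) :
    StronglyMeasurable fun z => T.fiberStar (p z) (f z) := by
  have hp : Measurable p := BorelProd.continuous_fst.measurable.comp hpq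
  have hα : StronglyMeasurable fun z => T.α (p z) (f z) := by
    convert T.stronglyMeasurable_α_indicator hH hHc hp hf using 1
    ext z
    by_cases hz : p z ∈ H
    · rw [Set.indicator_of_mem]
      exact hz
    · rw [Set.indicator_of_notMem (show z ∉ p ⁻¹' H from hz), hf0 z fun h => hz h.1, map_zero]
  have h := T.stronglyMeasurable_ω_snd hH hHc hpq hα fun z hz => by rw [hf0 z hz, map_zero]
  exact continuous_star.comp_stronglyMeasurable h

end TwistedAction

end Measurability

/-! ### Integrals of functions supported in an open `σ`-compact subgroup -/

section SupportedIntegral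

open Measure
open scoped ENNReal

theorem setLIntegral_eq_lintegral_of_forall_notMem {X : Type*} [MeasurableSpace X]
    {μ : Measure X} {S : Set X} (hS : MeasurableSet S)
    {f : X → ℝ≥0∞} (hf : ∀ x ∉ S, f x = 0) : ∫⁻ x in S, f x ∂μ = ∫⁻ x, f x ∂μ := by
  rw [← lintegral_indicator hS]
  congr 1
  exact Set.indicator_eq_self.2 fun x hx => by_contra fun h => hx (hf x h)

theorem mem_of_inv_mul_mem {G : Type*} [Group G] {H : Subgroup G} {x y : G} (hy : y ∈ H)
    (h : y⁻¹ * x ∈ H) : x ∈ H :=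
  (H.mul_mem_cancel_left (H.inv_mem hy)).1 h

theorem BorelProd.measurable_snd {X Y : Type*} [TopologicalSpace X]
    [TopologicalSpace Y] [MeasurableSpace Y] [BorelSpace Y] :
    Measurable (BorelProd.snd : BorelProd X Y → Y) :=
  BorelProd.continuous_snd.measurable

theorem BorelProd.continuous_inv_mul {G : Type*} [Group G] [TopologicalSpace G]
    [IsTopologicalGroup G] :
    Continuous (fun z : BorelProd G G => z.snd⁻¹ * z.fst) :=
  BorelProd.continuous_snd.inv.mul BorelProd.continuous_fst

variable {G : Type*} [Group G] [TopologicalSpace G] [IsTopologicalGroup G]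
  [LocallyCompactSpace G] [MeasurableSpace G] [BorelSpace G] {μ : Measure G}
  [μ.IsHaarMeasure] [μ.Regular] {H : Subgroup G}

/-- On `H` the measure is `σ`-finite, so the results for `BorelProd` apply to its restriction;
vanishing off `H` identifies restricted and full integrals. The next three lemmas rest on the same
reduction. -/
theorem measurable_lintegral_of_support (hH : IsOpen (H : Set G))
    (hHc : IsSigmaCompact (H : Set G)) {f : G → G → ℝ≥0∞}
    (hf : Measurable fun z : BorelProd G G => f z.fst z.snd) (h0 : ∀ x, ∀ y ∉ H, f x y = 0) :
    Measurable fun x => ∫⁻ y, f x y ∂μ := by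
  have := sigmaFinite_restrict_of_isSigmaCompact (μ := μ) hH.measurableSet hHc
  have h := BorelProd.measurable_lintegral_right (n := μ.restrict H) hf
  simpa only [fun x => setLIntegral_eq_lintegral_of_forall_notMem (μ := μ) hH.measurableSet (h0 x)]
    using h

theorem stronglyMeasurable_integral_of_support {E : Type*} [NormedAddCommGroup E]
    [NormedSpace ℝ E] (hH : IsOpen (H : Set G)) (hHc : IsSigmaCompact (H : Set G)) {f : G → G → E}
    (hf : StronglyMeasurable fun z : BorelProd G G => f z.fst z.snd)
    (h0 : ∀ x, ∀ y ∉ H, f x y = 0) : StronglyMeasurable fun x => ∫ y, f x y ∂μ := by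
  have := sigmaFinite_restrict_of_isSigmaCompact (μ := μ) hH.measurableSet hHc
  have h := BorelProd.stronglyMeasurable_integral_right (n := μ.restrict H) hf
  have h1 : ∀ x, ∫ y in H, f x y ∂μ = ∫ y, f x y ∂μ := fun x =>
    setIntegral_eq_integral_of_forall_compl_eq_zero (h0 x)
  simpa only [h1] using h

theorem lintegral_lintegral_swap_of_support (hH : IsOpen (H : Set G))
    (hHc : IsSigmaCompact (H : Set G)) {f : G → G → ℝ≥0∞}
    (hf : Measurable fun z : BorelProd G G => f z.fst z.snd)
    (h1 : ∀ x ∉ H, ∀ y, f x y = 0) (h2 : ∀ x, ∀ y ∉ H, f x y = 0) :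
    ∫⁻ x, ∫⁻ y, f x y ∂μ ∂μ = ∫⁻ y, ∫⁻ x, f x y ∂μ ∂μ := by
  have := sigmaFinite_restrict_of_isSigmaCompact (μ := μ) hH.measurableSet hHc
  have h := BorelProd.lintegral_lintegral_swap (m := μ.restrict H) (n := μ.restrict H) hf
  have e1 : ∀ x, ∫⁻ y in H, f x y ∂μ = ∫⁻ y, f x y ∂μ := fun x =>
    setLIntegral_eq_lintegral_of_forall_notMem hH.measurableSet (h2 x)
  have e2 : ∀ y, ∫⁻ x in H, f x y ∂μ = ∫⁻ x, f x y ∂μ := fun y =>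
    setLIntegral_eq_lintegral_of_forall_notMem hH.measurableSet fun x hx => h1 x hx y
  simp only [e1, e2] at h
  rwa [setLIntegral_eq_lintegral_of_forall_notMem hH.measurableSet,
    setLIntegral_eq_lintegral_of_forall_notMem hH.measurableSet] at h
  · exact fun y hy => by simp [h2 _ y hy]
  · exact fun x hx => by simp [h1 x hx]

theorem integral_integral_swap_of_support {E : Type*} [NormedAddCommGroup E]
    [NormedSpace ℝ E] [CompleteSpace E] (hH : IsOpen (H : Set G)) (hHc : IsSigmaCompact (H : Set G))
    {f : G → G → E} (hf : StronglyMeasurable fun z : BorelProd G G => f z.fst z.snd)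
    (h1 : ∀ x ∉ H, ∀ y, f x y = 0) (h2 : ∀ x, ∀ y ∉ H, f x y = 0)
    (hfin : ∫⁻ x, ∫⁻ y, ‖f x y‖ₑ ∂μ ∂μ ≠ ∞) :
    ∫ x, ∫ y, f x y ∂μ ∂μ = ∫ y, ∫ x, f x y ∂μ ∂μ := by
  have := sigmaFinite_restrict_of_isSigmaCompact (μ := μ) hH.measurableSet hHc
  have h := BorelProd.integral_integral_swap (m := μ.restrict H) (n := μ.restrict H) hf
    (ne_top_of_le_ne_top hfin ((setLIntegral_le_lintegral _ _).trans
      (lintegral_mono fun x => setLIntegral_le_lintegral _ _)))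
  have e1 : ∀ x, ∫ y in H, f x y ∂μ = ∫ y, f x y ∂μ := fun x =>
    setIntegral_eq_integral_of_forall_compl_eq_zero (h2 x)
  have e2 : ∀ y, ∫ x in H, f x y ∂μ = ∫ x, f x y ∂μ := fun y =>
    setIntegral_eq_integral_of_forall_compl_eq_zero fun x hx => h1 x hx y
  simp only [e1, e2] at h
  rwa [setIntegral_eq_integral_of_forall_compl_eq_zero,
    setIntegral_eq_integral_of_forall_compl_eq_zero] at h
  · exact fun y hy => by simp [h2 _ y hy]
  · exact fun x hx => by simp [h1 x hx]

theorem measurable_convolution_integrand {u v : G → ℝ≥0∞} (hu : Measurable u) (hv : Measurable v) :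
    Measurable fun z : BorelProd G G => u z.snd * v (z.snd⁻¹ * z.fst) :=
  (hu.comp BorelProd.measurable_snd).mul (hv.comp BorelProd.continuous_inv_mul.measurable)

/-- After the exchange of integrals, left invariance makes the inner integral of `v` independent of
`y`. -/
theorem lintegral_lintegral_mul_inv_mul (hH : IsOpen (H : Set G))
    (hHc : IsSigmaCompact (H : Set G)) {u v : G → ℝ≥0∞} (hu : Measurable u) (hv : Measurable v)
    (hu0 : ∀ x ∉ H, u x = 0) (hv0 : ∀ x ∉ H, v x = 0) :
    ∫⁻ x, ∫⁻ y, u y * v (y⁻¹ * x) ∂μ ∂μ = (∫⁻ x, u x ∂μ) * ∫⁻ x, v x ∂μ := by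
  have h2 : ∀ x, ∀ y ∉ H, u y * v (y⁻¹ * x) = 0 := fun x y hy => by rw [hu0 y hy, zero_mul]
  have h1 : ∀ x ∉ H, ∀ y, u y * v (y⁻¹ * x) = 0 := fun x hx y => by
    by_cases hy : y ∈ H
    · rw [hv0 _ fun h => hx (mem_of_inv_mul_mem hy h), mul_zero]
    · exact h2 x y hy
  rw [lintegral_lintegral_swap_of_support hH hHc (measurable_convolution_integrand hu hv) h1 h2]
  have : ∀ y, ∫⁻ x, u y * v (y⁻¹ * x) ∂μ = u y * ∫⁻ x, v x ∂μ := fun y => by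
    have hm : Measurable fun x => v (y⁻¹ * x) := hv.comp (measurable_const_mul _)
    rw [lintegral_const_mul _ hm,
      lintegral_mul_left_eq_self v y⁻¹]
  simp_rw [this]
  rw [lintegral_mul_const _ hu]

end SupportedIntegral

/-- A strongly measurable integrable function that vanishes off `H`. -/
structure IsIntegrableIn {G E : Type*} [MeasurableSpace G] [NormedAddCommGroup E]
    (μ : Measure G) (H : Set G) (f : G → E) : Prop where
  stronglyMeasurable : StronglyMeasurable f
  integrable : Integrable f μ
  eq_zero : ∀ x ∉ H, f x = 0

/-! ### Twisted convolution of functions supported in an open subgroup -/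

namespace TwistedAction

section Functions

open scoped ENNReal

variable {G B : Type*} [Group G] [TopologicalSpace G] [IsTopologicalGroup G]
  [LocallyCompactSpace G] [MeasurableSpace G] [BorelSpace G]
  [NonUnitalNormedRing B] [StarRing B] [NormedStarGroup B] [NormedSpace ℂ B]
  [IsScalarTower ℂ B B] [SMulCommClass ℂ B B] [StarModule ℂ B] (T : TwistedAction G B)
  {μ : Measure G} {H : Subgroup G} {f g h : G → B}

theorem convIntegrand_eq (f g : G → B) (x y : G) :
    T.convIntegrand f g x y = T.fiberMul y (y⁻¹ * x) (f y) (g (y⁻¹ * x)) := rfl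

theorem enorm_convIntegrand_le (f g : G → B) (x y : G) :
    ‖T.convIntegrand f g x y‖ₑ ≤ ‖f y‖ₑ * ‖g (y⁻¹ * x)‖ₑ := by
  rw [← ofReal_norm, ← ofReal_norm, ← ofReal_norm,
    ← ENNReal.ofReal_mul (norm_nonneg _)]
  exact ENNReal.ofReal_le_ofReal (T.norm_fiberMul_le _ _ _ _)

theorem convIntegrand_eq_zero_left (hf : IsIntegrableIn μ H f) (x : G) {y : G} (hy : y ∉ H) :
    T.convIntegrand f g x y = 0 := by
  rw [convIntegrand_eq, hf.eq_zero y hy, fiberMul_zero_left]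

theorem convIntegrand_eq_zero (hf : IsIntegrableIn μ H f) (hg : IsIntegrableIn μ H g) {x : G}
    (hx : x ∉ H) (y : G) : T.convIntegrand f g x y = 0 := by
  by_cases hy : y ∈ H
  · rw [convIntegrand_eq, hg.eq_zero _ fun h => hx (mem_of_inv_mul_mem hy h), fiberMul_zero_right]
  · exact T.convIntegrand_eq_zero_left hf x hy

theorem stronglyMeasurable_convIntegrand (hH : IsOpen (H : Set G))
    (hHc : IsSigmaCompact (H : Set G)) (hf : IsIntegrableIn μ H f) (hg : IsIntegrableIn μ H g) :
    StronglyMeasurable fun z : BorelProd G G => T.convIntegrand f g z.fst z.snd :=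
  T.stronglyMeasurable_fiberMul hH hHc
    (BorelProd.continuous_mk BorelProd.continuous_snd BorelProd.continuous_inv_mul).measurable
    (hf.stronglyMeasurable.comp_measurable BorelProd.measurable_snd)
    (hg.stronglyMeasurable.comp_measurable BorelProd.continuous_inv_mul.measurable)
    (fun _ hz => hf.eq_zero _ hz) (fun _ hz => hg.eq_zero _ hz)

theorem modularFunction_inv (x : G) :
    modularFunction G x⁻¹ = (Measure.modularCharacterFun x : ℝ) := by
  rw [modularFunction, inv_inv]

theorem invol_eq (f : G → B) (x : G) :
    T.invol f x = (modularFunction G x⁻¹ : ℂ) • T.fiberStar x (f x⁻¹) := by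
  rw [invol, fiberStar, DoubleCentralizer.star_fst, map_star (T.α x), star_star]

variable [μ.IsHaarMeasure] [μ.Regular]

theorem lintegral_lintegral_convIntegrand_le (hH : IsOpen (H : Set G))
    (hHc : IsSigmaCompact (H : Set G)) (hf : IsIntegrableIn μ H f) (hg : IsIntegrableIn μ H g) :
    ∫⁻ x, ∫⁻ y, ‖T.convIntegrand f g x y‖ₑ ∂μ ∂μ ≤ (∫⁻ x, ‖f x‖ₑ ∂μ) * ∫⁻ x, ‖g x‖ₑ ∂μ := by
  rw [← lintegral_lintegral_mul_inv_mul hH hHc hf.stronglyMeasurable.enorm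
    hg.stronglyMeasurable.enorm (fun x hx => by simp [hf.eq_zero x hx])
    (fun x hx => by simp [hg.eq_zero x hx])]
  exact lintegral_mono fun x => lintegral_mono fun y => T.enorm_convIntegrand_le f g x y

theorem ae_integrable_convIntegrand (hH : IsOpen (H : Set G))
    (hHc : IsSigmaCompact (H : Set G)) (hf : IsIntegrableIn μ H f) (hg : IsIntegrableIn μ H g) :
    ∀ᵐ x ∂μ, Integrable (T.convIntegrand f g x) μ := by
  have hm := T.stronglyMeasurable_convIntegrand hH hHc hf hg
  have hl : Measurable fun x => ∫⁻ y, ‖T.convIntegrand f g x y‖ₑ ∂μ :=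
    measurable_lintegral_of_support hH hHc (f := fun x y => ‖T.convIntegrand f g x y‖ₑ) hm.enorm
      fun x y hy => by rw [T.convIntegrand_eq_zero_left hf x hy, enorm_zero]
  have hfin := ne_top_of_le_ne_top
    (ENNReal.mul_ne_top hf.integrable.2.ne hg.integrable.2.ne)
    (T.lintegral_lintegral_convIntegrand_le hH hHc hf hg)
  filter_upwards [ae_lt_top hl hfin] with x hx
  exact ⟨(hm.comp_measurable (BorelProd.measurable_mk_left x)).aestronglyMeasurable, hx⟩

theorem lintegral_enorm_conv_le (hH : IsOpen (H : Set G))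
    (hHc : IsSigmaCompact (H : Set G)) (hf : IsIntegrableIn μ H f) (hg : IsIntegrableIn μ H g) :
    ∫⁻ x, ‖T.conv μ f g x‖ₑ ∂μ ≤ (∫⁻ x, ‖f x‖ₑ ∂μ) * ∫⁻ x, ‖g x‖ₑ ∂μ :=
  (lintegral_mono fun _ => enorm_integral_le_lintegral_enorm _).trans
    (T.lintegral_lintegral_convIntegrand_le hH hHc hf hg)

theorem isIntegrableIn_conv (hH : IsOpen (H : Set G))
    (hHc : IsSigmaCompact (H : Set G)) (hf : IsIntegrableIn μ H f) (hg : IsIntegrableIn μ H g) :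
    IsIntegrableIn μ H (T.conv μ f g) := by
  have hm : StronglyMeasurable (T.conv μ f g) :=
    stronglyMeasurable_integral_of_support hH hHc
      (T.stronglyMeasurable_convIntegrand hH hHc hf hg)
      fun x y hy => T.convIntegrand_eq_zero_left hf x hy
  refine ⟨hm, ⟨hm.aestronglyMeasurable, ?_⟩, fun x hx => ?_⟩
  · exact (T.lintegral_enorm_conv_le hH hHc hf hg).trans_lt
      (ENNReal.mul_lt_top hf.integrable.2 hg.integrable.2)
  · simp [conv, T.convIntegrand_eq_zero hf hg hx]

theorem convIntegrand_ae_eq [T2Space G] {f' g' : G → B} (hf : f =ᵐ[μ] f') (hg : g =ᵐ[μ] g')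
    (x : G) : T.convIntegrand f g x =ᵐ[μ] T.convIntegrand f' g' x := by
  filter_upwards [hf, (quasiMeasurePreserving_inv_mul_haar μ x).ae hg] with y h1 h2
  rw [convIntegrand_eq, convIntegrand_eq, h1, h2]

/-- Equality holds at every `x`, not just almost every one: for each fixed `x` the integrands agree
for almost every `y`. -/
theorem conv_congr [T2Space G] {f' g' : G → B} (hf : f =ᵐ[μ] f') (hg : g =ᵐ[μ] g') :
    T.conv μ f g = T.conv μ f' g' :=
  funext fun x => integral_congr_ae (T.convIntegrand_ae_eq hf hg x)

/-! ### Associativity -/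

/-- The domination needed for Fubini: the triple integrand is bounded by that of the scalar
convolution of the three norm functions, whose total integral is the product of the three norms. -/
theorem ae_lintegral_conv_conv_ne_top (hH : IsOpen (H : Set G))
    (hHc : IsSigmaCompact (H : Set G)) (hf : IsIntegrableIn μ H f) (hg : IsIntegrableIn μ H g)
    (hh : IsIntegrableIn μ H h) :
    ∀ᵐ x ∂μ, ∫⁻ y, ∫⁻ z, ‖T.fiberMul y (y⁻¹ * x)
      (T.fiberMul z (z⁻¹ * y) (f z) (g (z⁻¹ * y))) (h (y⁻¹ * x))‖ₑ ∂μ ∂μ ≠ ∞ := by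
  have hu := hf.stronglyMeasurable.enorm
  have hv := hg.stronglyMeasurable.enorm
  have hw := hh.stronglyMeasurable.enorm
  have hu0 : ∀ x ∉ H, ‖f x‖ₑ = 0 := fun x hx => by simp [hf.eq_zero x hx]
  have hv0 : ∀ x ∉ H, ‖g x‖ₑ = 0 := fun x hx => by simp [hg.eq_zero x hx]
  have hw0 : ∀ x ∉ H, ‖h x‖ₑ = 0 := fun x hx => by simp [hh.eq_zero x hx]
  let U : G → ℝ≥0∞ := fun y => ∫⁻ z, ‖f z‖ₑ * ‖g (z⁻¹ * y)‖ₑ ∂μ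
  have hU : Measurable U := measurable_lintegral_of_support hH hHc
    (f := fun y z => ‖f z‖ₑ * ‖g (z⁻¹ * y)‖ₑ)
    (measurable_convolution_integrand hu hv) fun x y hy => by rw [hu0 y hy, zero_mul]
  have hU0 : ∀ y ∉ H, U y = 0 := fun y hy => by
    have : ∀ z, ‖f z‖ₑ * ‖g (z⁻¹ * y)‖ₑ = 0 := fun z => by
      by_cases hz : z ∈ H
      · rw [hv0 _ fun h => hy (mem_of_inv_mul_mem hz h), mul_zero]
      · rw [hu0 z hz, zero_mul]
    simp [U, this]
  have hfin : ∫⁻ x, ∫⁻ y, U y * ‖h (y⁻¹ * x)‖ₑ ∂μ ∂μ ≠ ∞ := by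
    rw [lintegral_lintegral_mul_inv_mul hH hHc hU hw hU0 hw0,
      lintegral_lintegral_mul_inv_mul hH hHc hu hv hu0 hv0]
    exact ENNReal.mul_ne_top (ENNReal.mul_ne_top hf.integrable.2.ne hg.integrable.2.ne)
      hh.integrable.2.ne
  have hl : Measurable fun x => ∫⁻ y, U y * ‖h (y⁻¹ * x)‖ₑ ∂μ :=
    measurable_lintegral_of_support hH hHc (f := fun x y => U y * ‖h (y⁻¹ * x)‖ₑ)
      (measurable_convolution_integrand hU hw) fun x y hy => by rw [hU0 y hy, zero_mul]
  filter_upwards [ae_lt_top hl hfin] with x hx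
  refine ne_top_of_le_ne_top hx.ne (lintegral_mono fun y => ?_)
  have hm : Measurable fun z => ‖f z‖ₑ * ‖g (z⁻¹ * y)‖ₑ :=
    hu.mul (hv.comp (measurable_inv.mul_const y))
  dsimp only [U]
  rw [← lintegral_mul_const _ hm]
  refine lintegral_mono fun z => ?_
  refine (T.enorm_convIntegrand_le (fun _ => T.fiberMul z (z⁻¹ * y) (f z) (g (z⁻¹ * y)))
    h x y).trans
    (mul_le_mul_left (T.enorm_convIntegrand_le f g y z) _)

theorem conv_assoc_ae [T2Space G] [CompleteSpace B] (hH : IsOpen (H : Set G))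
    (hHc : IsSigmaCompact (H : Set G)) (hf : IsIntegrableIn μ H f) (hg : IsIntegrableIn μ H g)
    (hh : IsIntegrableIn μ H h) :
    T.conv μ (T.conv μ f g) h =ᵐ[μ] T.conv μ f (T.conv μ g h) := by
  filter_upwards [T.ae_lintegral_conv_conv_ne_top hH hHc hf hg hh] with x hx
  let F : G → G → B := fun y z => T.fiberMul y (y⁻¹ * x)
    (T.fiberMul z (z⁻¹ * y) (f z) (g (z⁻¹ * y))) (h (y⁻¹ * x))
  have hFm : StronglyMeasurable fun w : BorelProd G G => F w.fst w.snd :=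
    T.stronglyMeasurable_fiberMul hH hHc
      (BorelProd.continuous_mk BorelProd.continuous_fst
        (BorelProd.continuous_fst.inv.mul continuous_const)).measurable
      (T.stronglyMeasurable_convIntegrand hH hHc hf hg)
      (hh.stronglyMeasurable.comp_measurable
        (BorelProd.continuous_fst.inv.mul continuous_const).measurable)
      (fun w hw => T.convIntegrand_eq_zero hf hg hw _) (fun w hw => hh.eq_zero _ hw)
  have h1 : ∀ y ∉ H, ∀ z, F y z = 0 := fun y hy z => by
    have := T.convIntegrand_eq_zero hf hg hy z
    rw [convIntegrand_eq] at this
    simp only [F, this, fiberMul_zero_left]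
  have h2 : ∀ y, ∀ z ∉ H, F y z = 0 := fun y z hz => by
    simp only [F, hf.eq_zero z hz, fiberMul_zero_left]
  calc T.conv μ (T.conv μ f g) h x = ∫ y, ∫ z, F y z ∂μ ∂μ := by
        refine integral_congr_ae ?_
        filter_upwards [T.ae_integrable_convIntegrand hH hHc hf hg] with y hy
        exact ((T.fiberMulLeft y (y⁻¹ * x) (h (y⁻¹ * x))).integral_comp_comm hy).symm
    _ = ∫ z, ∫ y, F y z ∂μ ∂μ := integral_integral_swap_of_support hH hHc hFm h1 h2 hx
    -- Left translation `y = z w` turns `z⁻¹ y` into `w`, after which associativity in the fibres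
    -- applies.
    _ = ∫ z, ∫ w, F (z * w) z ∂μ ∂μ := by
        congr 1
        ext z
        exact (integral_mul_left_eq_self (fun y => F y z) z).symm
    _ = T.conv μ f (T.conv μ g h) x := by
        refine integral_congr_ae ?_
        -- The convolution integral of `g` and `h` is needed at the point `z⁻¹ x`; it converges
        -- there for almost every `z`.
        filter_upwards [(quasiMeasurePreserving_inv_mul_haar μ x).ae
          (T.ae_integrable_convIntegrand hH hHc hg hh)] with z hz
        refine Eq.trans ?_ ((T.fiberMulRight z (z⁻¹ * x) (f z)).integral_comp_comm hz)
        congr 1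
        ext w
        have e : (z * w)⁻¹ * x = w⁻¹ * (z⁻¹ * x) := by group
        simp only [F, e, inv_mul_cancel_left]
        rw [fiberMul_assoc, mul_inv_cancel_left]
        rfl

/-! ### Involution -/

theorem enorm_invol_le (f : G → B) (x : G) :
    ‖T.invol f x‖ₑ ≤ (Measure.modularCharacterFun x : ℝ≥0∞) * ‖f x⁻¹‖ₑ := by
  have h : ‖T.invol f x‖₊ ≤ Measure.modularCharacterFun x * ‖f x⁻¹‖₊ := by
    rw [invol_eq, modularFunction_inv, ← NNReal.coe_le_coe, coe_nnnorm, norm_smul]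
    simpa using mul_le_mul_of_nonneg_left (T.norm_fiberStar_le x (f x⁻¹)) (NNReal.coe_nonneg _)
  calc ‖T.invol f x‖ₑ ≤ ((Measure.modularCharacterFun x * ‖f x⁻¹‖₊ : NNReal) : ℝ≥0∞) :=
        ENNReal.coe_le_coe.2 h
    _ = (Measure.modularCharacterFun x : ℝ≥0∞) * ‖f x⁻¹‖ₑ := ENNReal.coe_mul _ _

theorem invol_invol (f : G → B) : T.invol (T.invol f) = f := by
  ext x
  have h : (Measure.modularCharacterFun x : ℂ) * (Measure.modularCharacterFun x⁻¹ : ℂ) = 1 := by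
    have h := Measure.modularCharacterFun_map_mul x x⁻¹
    rw [mul_inv_cancel, Measure.modularCharacterFun_map_one] at h
    exact_mod_cast congrArg (fun r : NNReal => ((r : ℝ) : ℂ)) h.symm
  rw [invol_eq, invol_eq, modularFunction_inv, modularFunction_inv, fiberStar_smul,
    Complex.conj_ofReal, smul_smul, inv_inv, fiberStar_fiberStar]
  exact (congrArg (· • f x) h).trans (one_smul _ _)

theorem invol_ae_eq [T2Space G] {f' : G → B} (hf : f =ᵐ[μ] f') : T.invol f =ᵐ[μ] T.invol f' := by
  filter_upwards [(quasiMeasurePreserving_inv_haar μ).ae hf] with x hx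
  rw [invol_eq, invol_eq, hx]

theorem lintegral_enorm_invol_le [T2Space G] (hH : IsOpen (H : Set G))
    (hHc : IsSigmaCompact (H : Set G)) (hf : IsIntegrableIn μ H f) :
    ∫⁻ x, ‖T.invol f x‖ₑ ∂μ ≤ ∫⁻ x, ‖f x‖ₑ ∂μ := by
  rw [← lintegral_modularCharacterFun_mul_inv hf.stronglyMeasurable.enorm hH.measurableSet
    hHc fun x hx => by simp [hf.eq_zero x hx]]
  exact lintegral_mono fun x => T.enorm_invol_le f x

theorem isIntegrableIn_invol [T2Space G] (hH : IsOpen (H : Set G))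
    (hHc : IsSigmaCompact (H : Set G)) (hf : IsIntegrableIn μ H f) :
    IsIntegrableIn μ H (T.invol f) := by
  have hm : StronglyMeasurable (T.invol f) := by
    have h1 : Continuous fun x : G => (modularFunction G x⁻¹ : ℂ) := by
      simp only [modularFunction_inv]
      exact Complex.continuous_ofReal.comp
        (NNReal.continuous_coe.comp continuous_modularCharacterFun)
    have h2 : StronglyMeasurable fun x => T.fiberStar x (f x⁻¹) :=
      T.stronglyMeasurable_fiberStar hH hHc (p := fun x => x)
        (BorelProd.continuous_mk continuous_id continuous_inv).measurable
        (hf.stronglyMeasurable.comp_measurable measurable_inv)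
        fun x hx => hf.eq_zero _ fun h => hx ⟨H.inv_mem_iff.1 h, h⟩
    rw [funext (T.invol_eq f)]
    exact h1.measurable.stronglyMeasurable.smul h2
  refine ⟨hm, ⟨hm.aestronglyMeasurable, ?_⟩, fun x hx => ?_⟩
  · exact (T.lintegral_enorm_invol_le hH hHc hf).trans_lt hf.integrable.2
  · rw [invol_eq, hf.eq_zero _ fun h => hx (H.inv_mem_iff.1 h), fiberStar_zero, smul_zero]

/-- The fibrewise adjoint of a product, after the left translation that replaces `x y` by `y`; the
scalar factors match because the modular character is multiplicative along `x = y (y⁻¹ x)`. -/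
theorem invol_conv_ae [T2Space G] [CompleteSpace B] (hH : IsOpen (H : Set G))
    (hHc : IsSigmaCompact (H : Set G)) (hf : IsIntegrableIn μ H f) (hg : IsIntegrableIn μ H g) :
    T.invol (T.conv μ f g) =ᵐ[μ] T.conv μ (T.invol g) (T.invol f) := by
  filter_upwards [(quasiMeasurePreserving_inv_haar μ).ae
    (T.ae_integrable_convIntegrand hH hHc hf hg)] with x hx
  have h1 : T.fiberStar x (T.conv μ f g x⁻¹) =
      ∫ y, T.fiberMul y (y⁻¹ * x) (T.fiberStar y (g y⁻¹))
        (T.fiberStar (y⁻¹ * x) (f (y⁻¹ * x)⁻¹)) ∂μ := by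
    refine (((T.fiberStarL x).integral_comp_comm hx).symm.trans ?_).trans
      (integral_mul_left_eq_self (fun y => T.fiberMul y (y⁻¹ * x) (T.fiberStar y (g y⁻¹))
        (T.fiberStar (y⁻¹ * x) (f (y⁻¹ * x)⁻¹))) x)
    congr 1
    ext y
    have e : (x * y)⁻¹ * x = y⁻¹ := by group
    rw [fiberStarL_apply, convIntegrand_eq, fiberStar_fiberMul, e, inv_inv, mul_inv_rev]
  rw [invol_eq, h1, conv, ← integral_smul]
  congr 1
  ext y
  rw [convIntegrand_eq, invol_eq, invol_eq, fiberMul_smul_left, fiberMul_smul_right, smul_smul,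
    modularFunction_inv, modularFunction_inv, modularFunction_inv, ← Complex.ofReal_mul,
    ← NNReal.coe_mul, ← Measure.modularCharacterFun_map_mul, mul_inv_cancel_left]

end Functions

end TwistedAction

/-! ### The Banach `*`-algebra of a twisted action -/

/-- A homomorphism with dense range into a Banach `*`-algebra maps an identity to an identity. -/
theorem IsIdentity.map_of_denseRange {A B : Type*} [Mul A] [NormedAddCommGroup B]
    [NormedSpace ℂ B] [Mul B] [Star B] (hB : IsBanachStarAlgebra B) {ι : A → B}
    (hmul : ∀ a b, ι (a * b) = ι a * ι b) (hdense : DenseRange ι) {e : A} (he : IsIdentity e) :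
    IsIdentity (ι e) := by
  have hl : Continuous fun b => ι e * b :=
    (LinearMap.mkContinuous (⟨⟨fun b => ι e * b, hB.mul_add _⟩, fun z b => hB.mul_smul z _ b⟩ :
      B →ₗ[ℂ] B) ‖ι e‖ (hB.norm_mul_le _)).continuous
  have hr : Continuous fun b => b * ι e :=
    (LinearMap.mkContinuous (⟨⟨fun b => b * ι e, fun a b => hB.add_mul a b _⟩,
      fun z b => hB.smul_mul z b _⟩ : B →ₗ[ℂ] B) ‖ι e‖
      (fun b => (hB.norm_mul_le _ _).trans_eq (mul_comm _ _))).continuous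
  intro b
  constructor
  · refine congrFun (hdense.equalizer hl continuous_id (funext fun a => ?_)) b
    simp only [Function.comp_apply, ← hmul, (he a).1, id]
  · refine congrFun (hdense.equalizer hr continuous_id (funext fun a => ?_)) b
    simp only [Function.comp_apply, ← hmul, (he a).2, id]

/-- Composition with a continuous linear map of dense range has dense range on `L¹`. -/
theorem ContinuousLinearMap.denseRange_compLpL {X E F : Type*} [MeasurableSpace X]
    [NormedAddCommGroup E] [NormedSpace ℂ E] [NormedAddCommGroup F] [NormedSpace ℂ F]
    (μ : Measure X) {L : E →L[ℂ] F} (hL : DenseRange L) :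
    DenseRange (L.compLpL 1 μ : Lp E 1 μ → Lp F 1 μ) := by
  set R := (LinearMap.range (L.compLpL 1 μ : Lp E 1 μ →ₗ[ℂ] Lp F 1 μ)).topologicalClosure
  have hR : ∀ f, f ∈ R := by
    refine Lp.induction ENNReal.one_ne_top _ (fun c s hs hμs => ?_) (fun f g hf hg _ h1 h2 =>
      R.add_mem h1 h2) (Submodule.isClosed_topologicalClosure _)
    rw [Lp.simpleFunc.coe_indicatorConst]
    -- By continuity in the constant, it is enough to treat constants in the dense range of `L`.
    have hcont : Continuous fun c : F => indicatorConstLp 1 hs hμs.ne c := by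
      refine (LipschitzWith.of_dist_le_mul (K := (μ.real s).toNNReal) fun c d => ?_).continuous
      rw [dist_eq_norm, indicatorConstLp_sub, dist_eq_norm]
      refine norm_indicatorConstLp_le.trans ?_
      simp [mul_comm]
    refine hL.induction_on (p := fun c => indicatorConstLp 1 hs hμs.ne c ∈ R) c
      ((Submodule.isClosed_topologicalClosure _).preimage hcont) fun a => ?_
    refine Submodule.le_topologicalClosure _ ⟨indicatorConstLp 1 hs hμs.ne a, ?_⟩
    refine Lp.ext ?_
    filter_upwards [L.coeFn_compLpL (indicatorConstLp 1 hs hμs.ne a),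
      indicatorConstLp_coeFn (p := 1) (hs := hs) (hμs := hμs.ne) (c := a),
      indicatorConstLp_coeFn (p := 1) (hs := hs) (hμs := hμs.ne) (c := L a)] with x h1 h2 h3
    refine h1.trans ?_
    rw [h2, h3]
    by_cases hx : x ∈ s <;> simp [hx]
  intro f
  exact hR f

namespace TwistedAction

section Algebra

open scoped ENNReal

variable {G B : Type*} [Group G] [TopologicalSpace G] [IsTopologicalGroup G]
  [LocallyCompactSpace G] [MeasurableSpace G] [BorelSpace G]
  [NonUnitalNormedRing B] [StarRing B] [NormedStarGroup B] [NormedSpace ℂ B]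
  [IsScalarTower ℂ B B] [SMulCommClass ℂ B B] [StarModule ℂ B] {T : TwistedAction G B}
  {μ : Measure G}

namespace L1

theorem integrable_fn (Φ : T.L1 μ) : Integrable Φ.fn μ :=
  MeasureTheory.L1.integrable_coeFn (show Lp B 1 μ from Φ)

theorem ext {Φ Ψ : T.L1 μ} (h : Φ.fn =ᵐ[μ] Ψ.fn) : Φ = Ψ :=
  Lp.ext (f := (show Lp B 1 μ from Φ)) (g := (show Lp B 1 μ from Ψ)) h

theorem fn_mk {F : G → B} (hF : Integrable F μ) : (L1.mk T μ F).fn =ᵐ[μ] F := by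
  rw [L1.mk, dif_pos hF]
  exact hF.coeFn_toL1

theorem fn_add (Φ Ψ : T.L1 μ) : (Φ + Ψ).fn =ᵐ[μ] fun x => Φ.fn x + Ψ.fn x :=
  Lp.coeFn_add (show Lp B 1 μ from Φ) (show Lp B 1 μ from Ψ)

theorem fn_smul (z : ℂ) (Φ : T.L1 μ) : (z • Φ).fn =ᵐ[μ] fun x => z • Φ.fn x :=
  Lp.coeFn_smul z (show Lp B 1 μ from Φ)

theorem norm_eq (Φ : T.L1 μ) : ‖Φ‖ = (∫⁻ x, ‖Φ.fn x‖ₑ ∂μ).toReal :=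
  MeasureTheory.L1.norm_def (show Lp B 1 μ from Φ)

theorem norm_eq_of_ae_eq {Φ : T.L1 μ} {F : G → B} (h : Φ.fn =ᵐ[μ] F) :
    ‖Φ‖ = (∫⁻ x, ‖F x‖ₑ ∂μ).toReal := by
  rw [norm_eq]
  exact congrArg _ (lintegral_congr_ae (h.fun_comp (‖·‖ₑ)))

theorem ofReal_norm_eq (Φ : T.L1 μ) : ENNReal.ofReal ‖Φ‖ = ∫⁻ x, ‖Φ.fn x‖ₑ ∂μ := by
  rw [norm_eq, ENNReal.ofReal_toReal (integrable_fn Φ).2.ne]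

theorem isIntegrableIn_fn {H : Set G} {Φ : T.L1 μ} (h : ∀ x ∉ H, Φ.fn x = 0) :
    IsIntegrableIn μ H Φ.fn :=
  ⟨Lp.stronglyMeasurable (show Lp B 1 μ from Φ), integrable_fn Φ, h⟩

variable [μ.IsHaarMeasure] [μ.Regular]

/-- Finitely many elements of `L¹` are supported in an open `σ`-compact subgroup. -/
theorem exists_isIntegrableIn (Φ Ψ Ξ : T.L1 μ) :
    ∃ H : Subgroup G, IsOpen (H : Set G) ∧ IsSigmaCompact (H : Set G) ∧
      IsIntegrableIn μ H Φ.fn ∧ IsIntegrableIn μ H Ψ.fn ∧ IsIntegrableIn μ H Ξ.fn := by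
  have hm : ∀ Φ : T.L1 μ, Measurable fun x => ‖Φ.fn x‖ₑ := fun Φ =>
    (Lp.stronglyMeasurable (show Lp B 1 μ from Φ)).enorm
  have hfin : ∫⁻ x, (‖Φ.fn x‖ₑ + ‖Ψ.fn x‖ₑ + ‖Ξ.fn x‖ₑ) ∂μ ≠ ∞ := by
    rw [lintegral_add_right _ (hm Ξ), lintegral_add_left (hm Φ)]
    exact ENNReal.add_ne_top.2 ⟨ENNReal.add_ne_top.2
      ⟨(integrable_fn Φ).2.ne, (integrable_fn Ψ).2.ne⟩, (integrable_fn Ξ).2.ne⟩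
  obtain ⟨H, hH, hHc, h0⟩ :=
    exists_subgroup_of_lintegral_ne_top (((hm Φ).add (hm Ψ)).add (hm Ξ)) hfin
  refine ⟨H, hH, hHc, ?_, ?_, ?_⟩ <;> refine isIntegrableIn_fn fun x hx => ?_ <;>
  · have h : ‖Φ.fn x‖ₑ + ‖Ψ.fn x‖ₑ + ‖Ξ.fn x‖ₑ = 0 := h0 x hx
    rw [add_eq_zero, add_eq_zero, enorm_eq_zero, enorm_eq_zero, enorm_eq_zero] at h
    simp [h]

variable (T μ) in
theorem operationsDefined [T2Space G] : T.L1OperationsDefined μ where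
  integrable_integrand Φ Ψ := by
    obtain ⟨H, hH, hHc, h1, h2, -⟩ := exists_isIntegrableIn Φ Ψ Ψ
    exact T.ae_integrable_convIntegrand hH hHc h1 h2
  integrable_conv Φ Ψ := by
    obtain ⟨H, hH, hHc, h1, h2, -⟩ := exists_isIntegrableIn Φ Ψ Ψ
    exact (T.isIntegrableIn_conv hH hHc h1 h2).integrable
  integrable_invol Φ := by
    obtain ⟨H, hH, hHc, h1, -, -⟩ := exists_isIntegrableIn Φ Φ Φ
    exact (T.isIntegrableIn_invol hH hHc h1).integrable

variable [T2Space G]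

theorem fn_mul (Φ Ψ : T.L1 μ) : (Φ * Ψ).fn =ᵐ[μ] T.conv μ Φ.fn Ψ.fn :=
  fn_mk ((operationsDefined T μ).integrable_conv Φ Ψ)

theorem fn_star (Φ : T.L1 μ) : (star Φ).fn =ᵐ[μ] T.invol Φ.fn :=
  fn_mk ((operationsDefined T μ).integrable_invol Φ)

/-- Half of the isometry of the involution; applied to `star Φ` it yields the other half. -/
theorem norm_star_le (Φ : T.L1 μ) : ‖star Φ‖ ≤ ‖Φ‖ := by
  obtain ⟨H, hH, hHc, h1, -, -⟩ := exists_isIntegrableIn Φ Φ Φ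
  rw [norm_eq_of_ae_eq (fn_star Φ), norm_eq]
  exact ENNReal.toReal_mono (integrable_fn Φ).2.ne (T.lintegral_enorm_invol_le hH hHc h1)

theorem star_star (Φ : T.L1 μ) : star (star Φ) = Φ := by
  refine ext ((fn_star _).trans ((T.invol_ae_eq (fn_star Φ)).trans ?_))
  rw [invol_invol]

theorem isBanachStarAlgebra [CompleteSpace B] : IsBanachStarAlgebra (T.L1 μ) where
  complete := inferInstanceAs (CompleteSpace (Lp B 1 μ))
  mul_assoc Φ Ψ Ξ := by
    obtain ⟨H, hH, hHc, h1, h2, h3⟩ := exists_isIntegrableIn Φ Ψ Ξ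
    refine ext ((fn_mul _ _).trans ?_)
    rw [T.conv_congr (fn_mul Φ Ψ) (ae_eq_refl Ξ.fn)]
    refine (T.conv_assoc_ae hH hHc h1 h2 h3).trans (Filter.EventuallyEq.symm ?_)
    refine (fn_mul _ _).trans ?_
    rw [T.conv_congr (ae_eq_refl Φ.fn) (fn_mul Ψ Ξ)]
  add_mul Φ Ψ Ξ := by
    have hd := operationsDefined T μ
    refine ext ((fn_mul _ _).trans ?_)
    rw [T.conv_congr (fn_add Φ Ψ) (ae_eq_refl Ξ.fn)]
    filter_upwards [fn_add (Φ * Ξ) (Ψ * Ξ), fn_mul Φ Ξ, fn_mul Ψ Ξ, hd.integrable_integrand Φ Ξ,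
      hd.integrable_integrand Ψ Ξ] with x h1 h2 h3 h4 h5
    rw [h1, h2, h3, conv, conv, conv, ← integral_add h4 h5]
    simp only [convIntegrand_eq, fiberMul_add_left]
  mul_add Φ Ψ Ξ := by
    have hd := operationsDefined T μ
    refine ext ((fn_mul _ _).trans ?_)
    rw [T.conv_congr (ae_eq_refl Φ.fn) (fn_add Ψ Ξ)]
    filter_upwards [fn_add (Φ * Ψ) (Φ * Ξ), fn_mul Φ Ψ, fn_mul Φ Ξ, hd.integrable_integrand Φ Ψ,
      hd.integrable_integrand Φ Ξ] with x h1 h2 h3 h4 h5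
    rw [h1, h2, h3, conv, conv, conv, ← integral_add h4 h5]
    simp only [convIntegrand_eq, fiberMul_add_right]
  smul_mul z Φ Ψ := by
    refine ext ((fn_mul _ _).trans ?_)
    rw [T.conv_congr (fn_smul z Φ) (ae_eq_refl Ψ.fn)]
    filter_upwards [fn_smul z (Φ * Ψ), fn_mul Φ Ψ] with x h1 h2
    rw [h1, h2, conv, conv, ← integral_smul]
    simp only [convIntegrand_eq, fiberMul_smul_left]
  mul_smul z Φ Ψ := by
    refine ext ((fn_mul _ _).trans ?_)
    rw [T.conv_congr (ae_eq_refl Φ.fn) (fn_smul z Ψ)]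
    filter_upwards [fn_smul z (Φ * Ψ), fn_mul Φ Ψ] with x h1 h2
    rw [h1, h2, conv, conv, ← integral_smul]
    simp only [convIntegrand_eq, fiberMul_smul_right]
  norm_mul_le Φ Ψ := by
    obtain ⟨H, hH, hHc, h1, h2, -⟩ := exists_isIntegrableIn Φ Ψ Ψ
    rw [norm_eq_of_ae_eq (fn_mul Φ Ψ), norm_eq, norm_eq, ← ENNReal.toReal_mul]
    exact ENNReal.toReal_mono (ENNReal.mul_ne_top (integrable_fn Φ).2.ne (integrable_fn Ψ).2.ne)
      (T.lintegral_enorm_conv_le hH hHc h1 h2)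
  star_star := star_star
  star_mul Φ Ψ := by
    obtain ⟨H, hH, hHc, h1, h2, -⟩ := exists_isIntegrableIn Φ Ψ Ψ
    refine ext ((fn_star _).trans ((T.invol_ae_eq (fn_mul Φ Ψ)).trans ?_))
    refine (T.invol_conv_ae hH hHc h1 h2).trans (Filter.EventuallyEq.symm ?_)
    refine (fn_mul _ _).trans ?_
    rw [T.conv_congr (fn_star Ψ) (fn_star Φ)]
  star_add Φ Ψ := by
    refine ext ((fn_star _).trans ((T.invol_ae_eq (fn_add Φ Ψ)).trans ?_))
    filter_upwards [fn_add (star Φ) (star Ψ), fn_star Φ, fn_star Ψ] with x h1 h2 h3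
    rw [h1, h2, h3, invol_eq, invol_eq, invol_eq, fiberStar_add, smul_add]
  star_smul z Φ := by
    refine ext ((fn_star _).trans ((T.invol_ae_eq (fn_smul z Φ)).trans ?_))
    filter_upwards [fn_smul (starRingEnd ℂ z) (star Φ), fn_star Φ] with x h1 h2
    rw [h1, h2, invol_eq, invol_eq, fiberStar_smul, smul_comm]
  norm_star Φ := (norm_star_le Φ).antisymm (by simpa only [star_star] using norm_star_le (star Φ))

end L1

end Algebra

/-! ### The inclusion of the two `L¹` algebras and the differential inequality -/

section Inclusion

open scoped ENNReal

variable {G A B : Type*} [Group G] [TopologicalSpace G] [IsTopologicalGroup G]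
  [LocallyCompactSpace G] [MeasurableSpace G] [BorelSpace G] {μ : Measure G}
  [NonUnitalNormedRing A] [StarRing A] [NormedStarGroup A] [NormedSpace ℂ A]
  [IsScalarTower ℂ A A] [SMulCommClass ℂ A A] [StarModule ℂ A]
  [NonUnitalNormedRing B] [StarRing B] [NormedStarGroup B] [NormedSpace ℂ B]
  [IsScalarTower ℂ B B] [SMulCommClass ℂ B B] [StarModule ℂ B]
  {S : TwistedAction G A} {T : TwistedAction G B} {ι : A →L[ℂ] B}

theorem fn_L1incl (Φ : S.L1 μ) : (L1incl S T μ ι Φ).fn =ᵐ[μ] fun x => ι (Φ.fn x) :=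
  ι.coeFn_compLpL (show Lp A 1 μ from Φ)

theorem L1incl_injective (hι : Function.Injective ι) :
    Function.Injective (L1incl S T μ ι) := fun Φ Ψ h => by
  refine L1.ext ?_
  have h1 := fn_L1incl (T := T) (ι := ι) Φ
  rw [h] at h1
  filter_upwards [h1, fn_L1incl (T := T) (ι := ι) Ψ] with x h2 h3
  exact hι (h2.symm.trans h3)

variable [T2Space G] [μ.IsHaarMeasure] [μ.Regular]

theorem L1incl_mul [CompleteSpace A] [CompleteSpace B]
    (hmul : ∀ a b : A, ι (a * b) = ι a * ι b) (hST : T.RestrictsTo ι S)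
    (Φ Ψ : S.L1 μ) : L1incl S T μ ι (Φ * Ψ) = L1incl S T μ ι Φ * L1incl S T μ ι Ψ := by
  refine L1.ext ((fn_L1incl _).trans (Filter.EventuallyEq.symm ((L1.fn_mul _ _).trans ?_)))
  rw [T.conv_congr (fn_L1incl Φ) (fn_L1incl Ψ)]
  filter_upwards [L1.fn_mul Φ Ψ, (L1.operationsDefined S μ).integrable_integrand Φ Ψ] with x h1 h2
  rw [h1, conv, conv, ← ι.integral_comp_comm h2]
  simp only [convIntegrand_eq, hST.map_fiberMul hmul]

theorem L1incl_star (hstar : ∀ a : A, ι (star a) = star (ι a)) (hST : T.RestrictsTo ι S)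
    (Φ : S.L1 μ) : L1incl S T μ ι (star Φ) = star (L1incl S T μ ι Φ) := by
  refine L1.ext ((fn_L1incl _).trans (Filter.EventuallyEq.symm ((L1.fn_star _).trans ?_)))
  refine (T.invol_ae_eq (fn_L1incl Φ)).trans ?_
  filter_upwards [L1.fn_star Φ] with x h1
  rw [h1, invol_eq, invol_eq, map_smul, hST.map_fiberStar hstar]

/-- The inequality of `A` is applied under the integral. Since `ι` intertwines the two actions and
both are isometric, `α_y` disappears from all norms, and each of the two resulting scalar
convolutions integrates to a product. -/
theorem norm_L1_mul_le {C : ℝ} (hC : 0 < C)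
    (hdiff : ∀ a b : A, ‖a * b‖ ≤ C * (‖a‖ * ‖ι b‖ + ‖ι a‖ * ‖b‖)) (hST : T.RestrictsTo ι S)
    (Φ Ψ : S.L1 μ) :
    ‖Φ * Ψ‖ ≤ C * (‖Φ‖ * ‖L1incl S T μ ι Ψ‖ + ‖L1incl S T μ ι Φ‖ * ‖Ψ‖) := by
  obtain ⟨H, hH, hHc, h1, h2, -⟩ := L1.exists_isIntegrableIn Φ Ψ Ψ
  have hι : ∀ Φ : S.L1 μ, ENNReal.ofReal ‖L1incl S T μ ι Φ‖ = ∫⁻ x, ‖ι (Φ.fn x)‖ₑ ∂μ :=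
    fun Φ => by
      rw [L1.ofReal_norm_eq]
      exact lintegral_congr_ae ((fn_L1incl Φ).fun_comp (‖·‖ₑ))
  have hfib : ∀ x y, ‖S.convIntegrand Φ.fn Ψ.fn x y‖ₑ ≤ ENNReal.ofReal C *
      (‖Φ.fn y‖ₑ * ‖ι (Ψ.fn (y⁻¹ * x))‖ₑ + ‖ι (Φ.fn y)‖ₑ * ‖Ψ.fn (y⁻¹ * x)‖ₑ) := fun x y => by
    simp only [← ofReal_norm]
    rw [← ENNReal.ofReal_mul (norm_nonneg _), ← ENNReal.ofReal_mul (norm_nonneg _),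
      ← ENNReal.ofReal_add (by positivity) (by positivity), ← ENNReal.ofReal_mul hC.le]
    refine ENNReal.ofReal_le_ofReal (((S.unitary_ω _ _).norm_snd_le _).trans
      ((hdiff _ _).trans_eq ?_))
    rw [hST.map_α, T.norm_α, S.norm_α]
  have hm1 := h1.stronglyMeasurable.enorm
  have hm2 := h2.stronglyMeasurable.enorm
  have hm3 := (ι.continuous.comp_stronglyMeasurable h1.stronglyMeasurable).enorm
  have hm4 := (ι.continuous.comp_stronglyMeasurable h2.stronglyMeasurable).enorm
  have hz1 : ∀ x ∉ H, ‖Φ.fn x‖ₑ = 0 := fun x hx => by simp [h1.eq_zero x hx]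
  have hz2 : ∀ x ∉ H, ‖Ψ.fn x‖ₑ = 0 := fun x hx => by simp [h2.eq_zero x hx]
  have hz3 : ∀ x ∉ H, ‖ι (Φ.fn x)‖ₑ = 0 := fun x hx => by simp [h1.eq_zero x hx]
  have hz4 : ∀ x ∉ H, ‖ι (Ψ.fn x)‖ₑ = 0 := fun x hx => by simp [h2.eq_zero x hx]
  have hc1 := measurable_lintegral_of_support (μ := μ) hH hHc
    (f := fun x y => ‖Φ.fn y‖ₑ * ‖ι (Ψ.fn (y⁻¹ * x))‖ₑ)
    (measurable_convolution_integrand hm1 hm4) fun x y hy => by rw [hz1 y hy, zero_mul]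
  rw [← ENNReal.ofReal_le_ofReal_iff (by positivity), ENNReal.ofReal_mul hC.le,
    ENNReal.ofReal_add (by positivity) (by positivity), ENNReal.ofReal_mul (norm_nonneg _),
    ENNReal.ofReal_mul (norm_nonneg _), hι, hι, L1.ofReal_norm_eq, L1.ofReal_norm_eq,
    L1.ofReal_norm_eq]
  calc ∫⁻ x, ‖(Φ * Ψ).fn x‖ₑ ∂μ = ∫⁻ x, ‖S.conv μ Φ.fn Ψ.fn x‖ₑ ∂μ :=
        lintegral_congr_ae ((L1.fn_mul Φ Ψ).fun_comp (‖·‖ₑ))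
    _ ≤ ∫⁻ x, ∫⁻ y, ENNReal.ofReal C * (‖Φ.fn y‖ₑ * ‖ι (Ψ.fn (y⁻¹ * x))‖ₑ +
          ‖ι (Φ.fn y)‖ₑ * ‖Ψ.fn (y⁻¹ * x)‖ₑ) ∂μ ∂μ :=
        lintegral_mono fun x => (enorm_integral_le_lintegral_enorm _).trans
          (lintegral_mono fun y => hfib x y)
    _ = ENNReal.ofReal C * (∫⁻ x, ∫⁻ y, ‖Φ.fn y‖ₑ * ‖ι (Ψ.fn (y⁻¹ * x))‖ₑ ∂μ ∂μ +
          ∫⁻ x, ∫⁻ y, ‖ι (Φ.fn y)‖ₑ * ‖Ψ.fn (y⁻¹ * x)‖ₑ ∂μ ∂μ) := by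
        rw [← lintegral_add_left hc1, ← lintegral_const_mul' _ _ ENNReal.ofReal_ne_top]
        congr 1
        ext x
        have hm : Measurable fun y => ‖Φ.fn y‖ₑ * ‖ι (Ψ.fn (y⁻¹ * x))‖ₑ :=
          hm1.mul (hm4.comp (measurable_inv.mul_const x))
        rw [lintegral_const_mul' _ _ ENNReal.ofReal_ne_top, lintegral_add_left hm]
    _ = _ := by
        rw [lintegral_lintegral_mul_inv_mul hH hHc hm1 hm4 hz1 hz4,
          lintegral_lintegral_mul_inv_mul hH hHc hm3 hm2 hz3 hz2]

end Inclusion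

end TwistedAction

theorem lemma2p6 {G A B : Type*}
    [Group G] [TopologicalSpace G] [IsTopologicalGroup G] [LocallyCompactSpace G] [T2Space G]
    [MeasurableSpace G] [BorelSpace G]
    (μ : Measure G) [μ.IsHaarMeasure] [μ.Regular]
    [NonUnitalNormedRing A] [StarRing A] [NormedStarGroup A] [NormedSpace ℂ A]
    [IsScalarTower ℂ A A] [SMulCommClass ℂ A A] [StarModule ℂ A] [CompleteSpace A]
    [NonUnitalNormedRing B] [StarRing B] [NormedStarGroup B] [NormedSpace ℂ B]
    [IsScalarTower ℂ B B] [SMulCommClass ℂ B B] [StarModule ℂ B] [CompleteSpace B]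
    (T : TwistedAction G B) (ι : A →L[ℂ] B)
    (hdiff : IsDifferentialSubalgebra ι) (hdense : DenseRange ι)
    (S : TwistedAction G A) (hstable : T.RestrictsTo ι S) :
    S.L1OperationsDefined μ ∧ T.L1OperationsDefined μ ∧
      IsDifferentialSubalgebra (TwistedAction.L1incl S T μ ι) ∧
      DenseRange (TwistedAction.L1incl S T μ ι) ∧
      IsInverseClosed (TwistedAction.L1incl S T μ ι) := by
  have hdense' : DenseRange (TwistedAction.L1incl S T μ ι) := ι.denseRange_compLpL μ hdense
  have hmul := TwistedAction.L1incl_mul (μ := μ) hdiff.map_mul hstable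
  have hdiff' : IsDifferentialSubalgebra (TwistedAction.L1incl S T μ ι) :=
    { banach_left := TwistedAction.L1.isBanachStarAlgebra
      banach_right := TwistedAction.L1.isBanachStarAlgebra
      injective := TwistedAction.L1incl_injective hdiff.injective
      map_mul := hmul
      map_star := TwistedAction.L1incl_star hdiff.map_star hstable
      -- The condition on identities is automatic for a homomorphism of dense range.
      map_identity := fun _ he =>
        he.map_of_denseRange TwistedAction.L1.isBanachStarAlgebra hmul hdense'
      norm_mul_le := by
        obtain ⟨C, hC, h⟩ := hdiff.norm_mul_le
        exact ⟨C, hC, TwistedAction.norm_L1_mul_le hC h hstable⟩ }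
  exact ⟨TwistedAction.L1.operationsDefined S μ, TwistedAction.L1.operationsDefined T μ, hdiff',
    hdense', hdiff'.isInverseClosed hdense'⟩
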